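/- Let $m\ge 1$, $n=2m$, let $K$ be a field (for instance $\mathbb C$) and $p,q\in K\setminus\{0\}$. Put $a=p^{-1}q^{-2}$, and in $K[z_1,\dots,z_n]$ extend the labels of the variables beyond $n$ by $z_{i+n}=a^{-2}z_i$; write $b_{jk}=qz_j-q^{-1}z_k$. For $1\le i\le n-1$ let $k_{i,i+1}$ exchange $z_i$ and $z_{i+1}$, and let $\bar t_i$ act from the right on the polynomials $\psi=b_{i,i+1}\varphi$ divisible by $b_{i,i+1}$ by $$\psi\,(\bar t_i+p^{-1})=b_{i,i+1}\,\frac{pz_i-p^{-1}z_{i+1}}{z_i-z_{i+1}}\,(\varphi-\varphi k_{i,i+1});$$ $\bar t_i^{-1}$ is the inverse of this operator. A basis tangle $\pi$ is a pairing of the points $1,\dots,n$ by strands (of two crossing strands, the one with the larger right end passes over the other). The maximally crossed tangle $\rho$ joins $i$ to $i+\frac n2$ for $1\le i\le \frac n2$, and $\bar\rho=\prod_{i=1}^n\prod_{k=1}^{n/2-1}b_{i,i+k}$. If the strands of $\pi$ ending at $i$ and $i+1$ ($1\le i\le n-1$) cross, exchanging their ends $i$ and $i+1$ gives a tangle $\pi'$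 with one crossing less; $\pi'=t_i\pi$ if, of the two strands, the one ending at $i$ goes to the right and the one ending at $i+1$ goes to the left, and $\pi'=t_i^{-1}\pi$ if both go to the right or both go to the left. Basis polynomials are constructed by starting with $\bar\rho$ for $\rho$ and, along such moves, setting $\bar\pi'=\bar\pi\,\bar t_i$, respectively $\bar\pi'=\bar\pi\,\bar t_i^{-1}$. Call $j<k$ matched in $\pi$ if no strand of $\pi$ connects two of the consecutive points $j,j+1,\dots,k$ (labels of points being taken modulo $n$). Then: 1. The construction is consistent: every tangle $\pi$ is reached, and the polynomial $\bar\pi$ does not depend on the sequence of moves leading from $\rho$ to $\pi$. 2. If $j$ and $k$ are matched in $\pi$, then $\bar\pi$ is divisible by $b_{jk}$. 3. In particular, whenever $\bar t_i$ or $\bar t_i^{-1}$ is applied to a polynomial $\bar\pi$ in the construction, $\bar\pi$ is divisible by $b_{i,i+1}$, and the result is a well-defined polynomial. -/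

import Mathlib

open MvPolynomial

namespace BMW

/-- A basis tangle on `n = 2 * m` points: the pairing of the points by its strands, i.e. a
fixed-point-free involution. The points `1, …, n` are labelled `0, …, n - 1` here. (In a basis
tangle, of two crossing strands the one whose right end is further right passes over the other,
so the pairing determines the tangle.) -/
structure Tangle (m : ℕ) where
  partner : Fin (2 * m) → Fin (2 * m)
  partner_partner : ∀ i, partner (partner i) = i
  partner_ne : ∀ i, partner i ≠ i

/-- The maximally crossed tangle `ρ`: the point `i` is joined to `i + n / 2` cyclically. -/
def Tangle.rho (m : ℕ) [NeZero m] : Tangle m where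
  partner i := ⟨(i.val + m) % (2 * m),
    Nat.mod_lt _ (Nat.mul_pos two_pos (Nat.pos_of_ne_zero (NeZero.ne m)))⟩
  partner_partner i := by
    have hm := Nat.pos_of_ne_zero (NeZero.ne m)
    have hi := i.isLt
    apply Fin.ext
    simp only [Nat.mod_add_mod]
    rw [show i.val + m + m = i.val + 2 * m by ring, Nat.add_mod_right, Nat.mod_eq_of_lt hi]
  partner_ne i := by
    have hm := Nat.pos_of_ne_zero (NeZero.ne m)
    have hi := i.isLt
    intro h
    have h' : (i.val + m) % (2 * m) = i.val := congrArg Fin.val h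
    rcases lt_or_ge (i.val + m) (2 * m) with h1 | h1
    · rw [Nat.mod_eq_of_lt h1] at h'
      omega
    · rw [Nat.mod_eq_sub_mod h1, Nat.mod_eq_of_lt (by omega)] at h'
      omega

/-- The tangle obtained by exchanging the strand ends at the points `i` and `j`. -/
def Tangle.exchange {m : ℕ} (π : Tangle m) (i j : Fin (2 * m)) : Tangle m where
  partner x := Equiv.swap i j (π.partner (Equiv.swap i j x))
  partner_partner x := by simp [π.partner_partner]
  partner_ne x h := π.partner_ne (Equiv.swap i j x) (by
    have h' := congrArg (Equiv.swap i j) h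
    simpa using h')

/-- `i` and `j = i + 1` are consecutive points whose strands cross, one of them running to the
right of its end in `{i, j}` and the other one to the left: with `a = π(j)` and `k = π(i)`,
`a < i < j < k`. Such a crossing is removed by `t_i`. -/
def Tangle.UntwistPos {m : ℕ} (π : Tangle m) (i j : Fin (2 * m)) : Prop :=
  i.val + 1 = j.val ∧ π.partner j < i ∧ j < π.partner i

/-- `i` and `j = i + 1` are consecutive points whose strands cross, both strands running to the
right (`i < j < π(i) < π(j)`) or both to the left (`π(i) < π(j) < i < j`). Such a crossing is
removed by `t_i⁻¹`. -/
def Tangle.UntwistInv {m : ℕ} (π : Tangle m) (i j : Fin (2 * m)) : Prop :=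
  i.val + 1 = j.val ∧
    ((j < π.partner i ∧ π.partner i < π.partner j) ∨
      (π.partner i < π.partner j ∧ π.partner j < i))

/-- The consecutive points `j, j + 1, …, k` (with `j < k`; labels are cyclic, that is, taken
modulo `n`) have no strand connecting any two among them: `j` and `k` are matched in `π`. -/
def Tangle.Matched {m : ℕ} [NeZero m] (π : Tangle m) (j k : ℕ) : Prop :=
  j < k ∧ ∀ a b : ℕ, j ≤ a → a ≤ k → j ≤ b → b ≤ k →
    π.partner (Fin.ofNat (2 * m) a) ≠ Fin.ofNat (2 * m) b

variable {K : Type*} [Field K]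

/-- The parameter `a = p⁻¹ q⁻²`. -/
def aParam (p q : K) : K := p⁻¹ * (q⁻¹) ^ 2

/-- The variable `z_i` for an unbounded label `i`, with `z_{i+n} = a⁻² z_i`. -/
noncomputable def z (m : ℕ) [NeZero m] (p q : K) (i : ℕ) : MvPolynomial (Fin (2 * m)) K :=
  C (((aParam p q)⁻¹ ^ 2) ^ (i / (2 * m))) * X (Fin.ofNat (2 * m) i)

/-- `b_{jk} = q z_j - q⁻¹ z_k`. -/
noncomputable def b (m : ℕ) [NeZero m] (p q : K) (j k : ℕ) : MvPolynomial (Fin (2 * m)) K :=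
  C q * z m p q j - C q⁻¹ * z m p q k

/-- `ρ̄ = ∏_{i=1}^{n} ∏_{k=1}^{n/2-1} b_{i,i+k}`. -/
noncomputable def rhoBar (m : ℕ) [NeZero m] (p q : K) : MvPolynomial (Fin (2 * m)) K :=
  ∏ i ∈ Finset.range (2 * m), ∏ k ∈ Finset.Icc 1 (m - 1), b m p q i (i + k)

/-- `ψ t̄_i = χ`, where `j = i + 1`. The operator `t̄_i` acts (on the right) on the polynomials
`ψ = b_{ij} φ` divisible by `b_{ij}`, by
`ψ (t̄_i + p⁻¹) = b_{ij} (p z_i - p⁻¹ z_j) (φ - φ k_{ij}) / (z_i - z_j)`,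
where `k_{ij}` exchanges the variables `z_i` and `z_j`. -/
def TBar {m : ℕ} [NeZero m] (p q : K) (i j : Fin (2 * m))
    (ψ χ : MvPolynomial (Fin (2 * m)) K) : Prop :=
  ∃ φ, ψ = b m p q i j * φ ∧
    (X i - X j) * (χ + C p⁻¹ * ψ) =
      b m p q i j * ((C p * X i - C p⁻¹ * X j) * (φ - rename (Equiv.swap i j) φ))

/-- `ψ t̄_i⁻¹ = χ`, that is, `χ t̄_i = ψ`. -/
def TBarInv {m : ℕ} [NeZero m] (p q : K) (i j : Fin (2 * m))
    (ψ χ : MvPolynomial (Fin (2 * m)) K) : Prop :=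
  TBar p q i j χ ψ

/-- `f` is a basis polynomial `π̄` of the tangle `π`: it is obtained from `ρ̄` by applying
`t̄_i` or `t̄_i⁻¹` along some sequence of moves by `t_i` or `t_i⁻¹` which leads from `ρ` to `π`,
each of them removing one crossing. -/
inductive IsBasisPoly {m : ℕ} [NeZero m] (p q : K) :
    Tangle m → MvPolynomial (Fin (2 * m)) K → Prop
  | rho : IsBasisPoly p q (Tangle.rho m) (rhoBar m p q)
  | pos {π : Tangle m} {f g : MvPolynomial (Fin (2 * m)) K} {i j : Fin (2 * m)} :
      IsBasisPoly p q π f → π.UntwistPos i j → TBar p q i j f g →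
        IsBasisPoly p q (π.exchange i j) g
  | inv {π : Tangle m} {f g : MvPolynomial (Fin (2 * m)) K} {i j : Fin (2 * m)} :
      IsBasisPoly p q π f → π.UntwistInv i j → TBarInv p q i j f g →
        IsBasisPoly p q (π.exchange i j) g

end BMW

open MvPolynomial

namespace BMW

/-! ### Tangles: adding crossings, and a rank that this lowers. -/

section Combinatorics

variable {m : ℕ}

/-! Read backwards, a move exchanges adjacent ends of two strands that do not cross, and so adds a
crossing. This lowers the sum of squared cyclic distances (`Tangle.Split.rank_exchange_lt`), and
only ρ admits no such step (`Tangle.eq_rho`). Hence the moves lead from ρ to every tangle, and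
induction on the rank is available.

Independence of the moves is a confluence argument. On rational functions t̄_i becomes an everywhere
defined invertible operator, conjugate to a Demazure–Lusztig operator; it satisfies quadratic, braid
and commutation relations. Two last moves leading to π are compared: disjoint ones commute,
overlapping ones are reconciled by a braid relation whose signs are forced by the directions of the
strands. One case remains: the two moves may remove one and the same crossing at its two ends. It
requires t̄_i and t̄_j to agree on the polynomial of a tangle with parallel strands i–j and
(i+1)–(j+1). This is proved together with uniqueness (`BraidAction.coherent`): braid relations pull
third strands across the parallel pair until ρ is reached, and there it is a computation
(`heckeOp_rhoBar_aux`) in which the value of a enters.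

Divisibility follows the moves. A free arc of the new tangle gives two free arcs of the old one,
interchanged by k_{i,i+1} (`Tangle.freeArc_of_exchange`); since linear forms are prime, both
divisors survive the operator (`TBar.linear_dvd`). The factor b_{i,i+1} survives because the
operator preserves its multiples. The ends of a removable crossing are matched, so divisibility also
makes the next move defined, which yields existence. -/

@[ext]
theorem Tangle.ext' {π π' : Tangle m} (h : ∀ x, π.partner x = π'.partner x) : π = π' := by
  cases π; cases π'; congr; exact funext h

theorem Tangle.partner_inj (π : Tangle m) {x y : Fin (2 * m)} :
    π.partner x = π.partner y ↔ x = y :=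
  ⟨fun h => by rw [← π.partner_partner x, h, π.partner_partner], fun h => h ▸ rfl⟩

theorem Tangle.partner_eq_iff (π : Tangle m) {x y : Fin (2 * m)} :
    π.partner x = y ↔ x = π.partner y :=
  ⟨fun h => by rw [← h, π.partner_partner], fun h => by rw [h, π.partner_partner]⟩

theorem Tangle.exchange_partner (π : Tangle m) (i j x : Fin (2 * m)) :
    (π.exchange i j).partner x = Equiv.swap i j (π.partner (Equiv.swap i j x)) := rfl

@[simp]
theorem Tangle.exchange_exchange (π : Tangle m) (i j : Fin (2 * m)) :
    (π.exchange i j).exchange i j = π := by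
  ext x; simp [Tangle.exchange_partner]

/-- The adjacent points `i` and `j = i + 1` are ends of two different strands that do not cross. -/
def Tangle.Split (π : Tangle m) (i j : Fin (2 * m)) : Prop :=
  i.val + 1 = j.val ∧ π.partner i ≠ j ∧
    ((π.partner i < i ∧ j < π.partner j) ∨ (j < π.partner j ∧ π.partner j < π.partner i) ∨
      (π.partner j < π.partner i ∧ π.partner i < i))

/-- The strand at `i` runs to the left and the one at `j` to the right. -/
def Tangle.Diverge (π : Tangle m) (i j : Fin (2 * m)) : Prop :=
  π.partner i < i ∧ j < π.partner j

theorem Tangle.exchange_left (π : Tangle m) {i j : Fin (2 * m)} (h : π.partner i ≠ j) :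
    (π.exchange i j).partner i = π.partner j := by
  rw [π.exchange_partner, Equiv.swap_apply_left, Equiv.swap_apply_of_ne_of_ne _ (π.partner_ne j)]
  intro h'; exact h (by rw [← h', π.partner_partner])

theorem Tangle.exchange_right (π : Tangle m) {i j : Fin (2 * m)} (h : π.partner i ≠ j) :
    (π.exchange i j).partner j = π.partner i := by
  rw [π.exchange_partner, Equiv.swap_apply_right, Equiv.swap_apply_of_ne_of_ne (π.partner_ne i) h]

theorem Tangle.exchange_of_ne (π : Tangle m) {i j x : Fin (2 * m)} (hi : x ≠ i) (hj : x ≠ j) :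
    (π.exchange i j).partner x = Equiv.swap i j (π.partner x) := by
  rw [π.exchange_partner, Equiv.swap_apply_of_ne_of_ne hi hj]

theorem Tangle.partner_ne_of_untwistPos {π : Tangle m} {i j : Fin (2 * m)}
    (h : π.UntwistPos i j) : π.partner i ≠ j := by
  rintro rfl; exact absurd h.2.2 (lt_irrefl _)

theorem Tangle.partner_ne_of_untwistInv {π : Tangle m} {i j : Fin (2 * m)}
    (h : π.UntwistInv i j) : π.partner i ≠ j := by
  rintro rfl
  obtain ⟨h1, h | h⟩ := h
  · exact absurd h.1 (lt_irrefl _)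
  · rw [π.partner_partner] at h; exact absurd h.2 (lt_irrefl _)

theorem Tangle.UntwistPos.split_exchange {π : Tangle m} {i j : Fin (2 * m)}
    (h : π.UntwistPos i j) : (π.exchange i j).Split i j ∧ (π.exchange i j).Diverge i j := by
  have hne := Tangle.partner_ne_of_untwistPos h
  unfold Tangle.Split Tangle.Diverge
  rw [π.exchange_left hne, π.exchange_right hne]
  have := π.partner_ne j
  exact ⟨⟨h.1, this, Or.inl h.2⟩, h.2⟩

theorem Tangle.UntwistInv.split_exchange {π : Tangle m} {i j : Fin (2 * m)}
    (h : π.UntwistInv i j) : (π.exchange i j).Split i j ∧ ¬ (π.exchange i j).Diverge i j := by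
  have hne := Tangle.partner_ne_of_untwistInv h
  unfold Tangle.Split Tangle.Diverge
  rw [π.exchange_left hne, π.exchange_right hne]
  have := π.partner_ne j
  obtain ⟨h1, h2⟩ := h
  refine ⟨⟨h1, this, Or.inr ?_⟩, ?_⟩
  · exact h2
  · simp only [Fin.lt_def] at *; omega

theorem Tangle.Split.untwist {π : Tangle m} {i j : Fin (2 * m)} (h : π.Split i j) :
    (π.Diverge i j → (π.exchange i j).UntwistPos i j) ∧
      (¬ π.Diverge i j → (π.exchange i j).UntwistInv i j) := by
  obtain ⟨h1, hne, h2⟩ := h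
  unfold Tangle.UntwistPos Tangle.UntwistInv
  rw [π.exchange_left hne, π.exchange_right hne]
  exact ⟨fun h => ⟨h1, h⟩, fun h => ⟨h1, h2.resolve_left h⟩⟩

/-! ### The only tangle without adjacent non-crossing strands is `ρ` -/

/-- The cyclic distance from a point to its partner, going to the right. -/
def Tangle.dist (π : Tangle m) (x : Fin (2 * m)) : ℕ :=
  if x < π.partner x then (π.partner x).val - x.val else (π.partner x).val + 2 * m - x.val

theorem Tangle.dist_add_dist (π : Tangle m) (x : Fin (2 * m)) :
    π.dist x + π.dist (π.partner x) = 2 * m := by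
  unfold Tangle.dist
  rw [π.partner_partner]
  have := π.partner_ne x
  simp only [Fin.lt_def, ne_eq, Fin.ext_iff] at *
  split_ifs <;> omega

/-- Neighbouring strands must now cross or coincide, and in each crossing pattern the distance to
the right does not drop. -/
theorem Tangle.dist_le_succ {π : Tangle m} (h : ∀ i j, ¬ π.Split i j) {i j : Fin (2 * m)}
    (hij : i.val + 1 = j.val) : π.dist i ≤ π.dist j := by
  by_cases hne : π.partner i = j
  · have hne' : π.partner j = i := by rw [← hne, π.partner_partner]
    -- A strand joining two neighbours crosses no strand, so a further point beside it would give a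
    -- split pair. Hence n = 2, where both distances are 1.
    have h1 : j.val + 1 = 2 * m := by
      by_contra hc
      let k : Fin (2 * m) := ⟨j.val + 1, by omega⟩
      have := h j k
      have hk1 : π.partner k ≠ i := fun e => by
        have : k = j := by rw [← hne, ← e, π.partner_partner]
        simp [k, Fin.ext_iff] at this
      have hk2 : π.partner k ≠ j := fun e => by
        have : k = i := by rw [← hne', ← e, π.partner_partner]
        simp [k, Fin.ext_iff] at this; omega
      have hk3 := π.partner_ne k
      unfold Tangle.Split at this
      rw [hne'] at this
      simp only [Fin.lt_def, ne_eq, Fin.ext_iff, k, true_and] at *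
      omega
    have h2 : i.val = 0 := by
      by_contra hc
      let k : Fin (2 * m) := ⟨i.val - 1, by omega⟩
      have := h k i
      have hk1 : π.partner k ≠ i := fun e => by
        have : k = j := by rw [← hne, ← e, π.partner_partner]
        simp [k, Fin.ext_iff] at this; omega
      have hk2 : π.partner k ≠ j := fun e => by
        have : k = i := by rw [← hne', ← e, π.partner_partner]
        simp [k, Fin.ext_iff] at this; omega
      have hk3 := π.partner_ne k
      unfold Tangle.Split at this
      rw [hne] at this
      simp only [Fin.lt_def, ne_eq, Fin.ext_iff, k] at *
      omega
    unfold Tangle.dist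
    rw [hne, hne']
    simp only [Fin.lt_def]
    split_ifs <;> omega
  · have h1 := h i j
    have h2 := π.partner_ne i
    have h3 := π.partner_ne j
    have h4 : π.partner j ≠ i := fun e => hne (by rw [← e, π.partner_partner])
    have h5 : π.partner i ≠ π.partner j := fun e => by
      have := π.partner_inj.1 e
      rw [this] at hij; omega
    unfold Tangle.Split at h1
    unfold Tangle.dist
    simp only [Fin.lt_def, ne_eq, Fin.ext_iff] at *
    split_ifs <;> omega

theorem Tangle.dist_mono {π : Tangle m} (h : ∀ i j, ¬ π.Split i j) {x y : Fin (2 * m)}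
    (hxy : x ≤ y) : π.dist x ≤ π.dist y := by
  obtain ⟨y, hy⟩ := y
  induction y with
  | zero =>
    have : x = ⟨0, hy⟩ := by
      ext; simp only [Fin.le_def] at hxy; simpa using hxy
    rw [this]
  | succ y ih =>
    by_cases hx : x = ⟨y + 1, hy⟩
    · rw [hx]
    · have : x.val ≤ y := by
        simp only [Fin.le_def, Fin.ext_iff] at *; omega
      exact (ih (by omega) this).trans (Tangle.dist_le_succ h rfl)

/-- Distances increase weakly from the first point on, and those of partners add up to 2m. So it
suffices that the smallest one, at the first point, is at least m: then all are equal to m. -/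
theorem Tangle.eq_rho [NeZero m] {π : Tangle m} (h : ∀ i j, ¬ π.Split i j) :
    π = Tangle.rho m := by
  have hm := Nat.pos_of_ne_zero (NeZero.ne m)
  obtain ⟨o, ho0⟩ : ∃ o : Fin (2 * m), o.val = 0 := ⟨⟨0, by omega⟩, rfl⟩
  have ho : ∀ x, π.dist o ≤ π.dist x := fun x => Tangle.dist_mono h (by simp [ho0, Fin.le_def])
  have hne := π.partner_ne o
  have hd0 : π.dist o = (π.partner o).val := by
    unfold Tangle.dist
    simp only [Fin.lt_def, ne_eq, Fin.ext_iff] at *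
    split_ifs <;> omega
  have hle : m ≤ π.dist o := by
    by_contra hlt
    -- The partner of `o` sits at d = `π.dist o` and has the maximal distance 2m − d. By
    -- monotonicity the point 2d has it too, so its partner is again the point d, which belongs to
    -- `o`.
    obtain ⟨y, hy⟩ : ∃ y : Fin (2 * m), y.val = 2 * π.dist o := ⟨⟨2 * π.dist o, by omega⟩, rfl⟩
    have h1 : π.dist (π.partner o) ≤ π.dist y :=
      Tangle.dist_mono h (by simp only [Fin.le_def]; omega)
    have h2 := π.dist_add_dist o
    have h3 := π.dist_add_dist y
    have h4 := ho (π.partner y)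
    have h5 : π.partner y = π.partner o := by
      have h6 : π.dist y = 2 * m - π.dist o := by omega
      rw [Tangle.dist] at h6
      ext
      clear h
      simp only [Fin.lt_def, ne_eq, Fin.ext_iff] at *
      split_ifs at h6 <;> omega
    have h6 := π.partner_inj.1 h5
    simp only [Fin.ext_iff, ne_eq] at h6 hne
    omega
  ext x
  have h1 := π.dist_add_dist x
  have h2 := ho x
  have h3 := ho (π.partner x)
  have h4 : π.dist x = m := by omega
  unfold Tangle.dist at h4
  show _ = (x.val + m) % (2 * m)
  have := x.isLt
  have := (π.partner x).isLt
  simp only [Fin.lt_def] at h4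
  split_ifs at h4
  · rw [Nat.mod_eq_of_lt] <;> omega
  · rw [Nat.mod_eq_sub_mod (by omega), Nat.mod_eq_of_lt] <;> omega

theorem Tangle.rho_val [NeZero m] (x : Fin (2 * m)) :
    (((Tangle.rho m).partner x).val = x.val + m ∧ x.val < m) ∨
      (((Tangle.rho m).partner x).val + m = x.val ∧ m ≤ x.val) := by
  have := x.isLt
  rcases lt_or_ge x.val m with h | h
  · left
    exact ⟨Nat.mod_eq_of_lt (by omega), h⟩
  · right
    refine ⟨?_, h⟩
    show (x.val + m) % (2 * m) + m = x.val
    rw [Nat.mod_eq_sub_mod (by omega), Nat.mod_eq_of_lt] <;> omega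

theorem Tangle.not_split_rho [NeZero m] (i j : Fin (2 * m)) : ¬ (Tangle.rho m).Split i j := by
  rintro ⟨h1, h2, h3⟩
  have := Tangle.rho_val i
  have := Tangle.rho_val j
  simp only [Fin.lt_def, ne_eq, Fin.ext_iff] at *
  omega

/-! ### A rank which decreases when a crossing is added -/

/-- The sum of the squares of the cyclic distances between the ends of the strands. -/
def Tangle.rank (π : Tangle m) : ℕ := ∑ x, π.dist x ^ 2

theorem Tangle.Split.dist_lt {π : Tangle m} {i j : Fin (2 * m)} (h : π.Split i j) :
    π.dist j + 2 ≤ π.dist i := by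
  obtain ⟨h1, h2, h3⟩ := h
  have := π.partner_ne j
  have := π.partner_ne i
  unfold Tangle.dist
  simp only [Fin.lt_def, ne_eq, Fin.ext_iff] at *
  split_ifs <;> omega

theorem Tangle.Split.partner_right_ne {π : Tangle m} {i j : Fin (2 * m)} (h : π.Split i j) :
    π.partner j ≠ i := fun e => h.2.1 (by rw [← e, π.partner_partner])

theorem Tangle.Split.dist_exchange {π : Tangle m} {i j : Fin (2 * m)} (h : π.Split i j)
    (x : Fin (2 * m)) :
    ((π.exchange i j).dist (Equiv.swap i j x) : ℤ) = π.dist x +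
      ((if x = i then -1 else 0) + (if x = j then 1 else 0) + (if x = π.partner i then 1 else 0)
        + (if x = π.partner j then -1 else 0)) := by
  have h0 := h.partner_right_ne
  obtain ⟨h1, h2, h3⟩ := h
  have hi := π.partner_ne i
  have hj := π.partner_ne j
  have hx := π.partner_ne x
  have e1 : x = π.partner i ↔ π.partner x = i := by rw [π.partner_eq_iff]
  have e2 : x = π.partner j ↔ π.partner x = j := by rw [π.partner_eq_iff]
  have e3 : x = i → π.partner x = π.partner i := fun h => by rw [h]
  have e4 : x = j → π.partner x = π.partner j := fun h => by rw [h]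
  unfold Tangle.dist
  rw [π.exchange_partner, Equiv.swap_apply_self]
  simp only [e1, e2]
  generalize π.partner x = y at *
  rw [Equiv.swap_apply_def, Equiv.swap_apply_def]
  simp only [Fin.lt_def, ne_eq, Fin.ext_iff] at *
  split_ifs <;> omega

/-- Four distances change by ±1. As the distances of partners are complementary in 2m, the squares
change in total by 4(1 + d_j − d_i), which is at most −4 by `Tangle.Split.dist_lt`. -/
theorem Tangle.Split.rank_exchange_lt {π : Tangle m} {i j : Fin (2 * m)} (h : π.Split i j) :
    (π.exchange i j).rank < π.rank := by
  have h0 := h.partner_right_ne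
  have hi := π.partner_ne i
  have hj := π.partner_ne j
  have hij : i ≠ j := by have := h.1; intro e; rw [e] at this; omega
  have hp : π.partner i ≠ π.partner j := fun e => hij (π.partner_inj.1 e)
  have h2 := h.2.1
  have hd := h.dist_lt
  have key : ∀ x, (((π.exchange i j).dist (Equiv.swap i j x) : ℤ)) ^ 2 = (π.dist x : ℤ) ^ 2 +
      ((if x = i then 1 - 2 * (π.dist i : ℤ) else 0) + (if x = j then 1 + 2 * (π.dist j : ℤ) else 0)
      + (if x = π.partner i then 1 + 2 * (π.dist (π.partner i) : ℤ) else 0)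
      + (if x = π.partner j then 1 - 2 * (π.dist (π.partner j) : ℤ) else 0)) := by
    intro x
    rw [h.dist_exchange]
    by_cases x1 : x = i
    · subst x1; simp [hij, hi.symm, h0.symm]; ring
    by_cases x2 : x = j
    · subst x2; simp [hij.symm, hj.symm, h2.symm]; ring
    by_cases x3 : x = π.partner i
    · subst x3; simp [hi, h2, hp]; ring
    by_cases x4 : x = π.partner j
    · subst x4; simp [h0, hj, hp.symm]; ring
    simp [x1, x2, x3, x4]
  have : ((π.exchange i j).rank : ℤ) < π.rank := by
    unfold Tangle.rank
    push_cast
    rw [← Equiv.sum_comp (Equiv.swap i j), Finset.sum_congr rfl (fun x _ => key x)]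
    simp only [Finset.sum_add_distrib, Finset.sum_ite_eq', Finset.mem_univ, if_true]
    have d1 := π.dist_add_dist i
    have d2 := π.dist_add_dist j
    zify at d1 d2 hd
    linarith
  exact_mod_cast this

/-! ### Exchanging at two pairs of adjacent points -/

theorem Tangle.exchange_comm (π : Tangle m) {i j k l : Fin (2 * m)} (hik : i ≠ k) (hil : i ≠ l)
    (hjk : j ≠ k) (hjl : j ≠ l) :
    (π.exchange i j).exchange k l = (π.exchange k l).exchange i j := by
  have hc : ∀ x, Equiv.swap i j (Equiv.swap k l x) = Equiv.swap k l (Equiv.swap i j x) := by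
    intro x
    simp only [Equiv.swap_apply_def]
    split_ifs <;> simp_all
  ext x
  simp only [Tangle.exchange_partner, hc]

theorem Tangle.exchange_braid (π : Tangle m) {i j k : Fin (2 * m)} (hij : i ≠ j) (hik : i ≠ k)
    (hjk : j ≠ k) :
    ((π.exchange i j).exchange j k).exchange i j =
      ((π.exchange j k).exchange i j).exchange j k := by
  have hc : ∀ x, Equiv.swap i j (Equiv.swap j k (Equiv.swap i j x)) =
      Equiv.swap j k (Equiv.swap i j (Equiv.swap j k x)) := by
    intro x
    simp only [Equiv.swap_apply_def]
    split_ifs <;> simp_all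
  ext x
  simp only [Tangle.exchange_partner, hc]

/-- If the strands at `i, i'` and those at `k, l` are nested inside one another, exchanging at
either end gives the same tangle. -/
theorem Tangle.exchange_eq_of_nested (π : Tangle m) {i i' k l : Fin (2 * m)} (hi : i ≠ i')
    (hkl : k ≠ l) (hik : i ≠ k) (hil : i ≠ l) (hjk : i' ≠ k) (hjl : i' ≠ l)
    (h1 : π.partner i = l) (h2 : π.partner i' = k) :
    π.exchange i i' = π.exchange k l := by
  have h3 : π.partner l = i := by rw [← h1, π.partner_partner]
  have h4 : π.partner k = i' := by rw [← h2, π.partner_partner]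
  ext x
  simp only [Tangle.exchange_partner]
  have e1 : ∀ y, y ≠ i → y ≠ i' → y ≠ k → y ≠ l → Equiv.swap i i' y = y ∧ Equiv.swap k l y = y :=
    fun y a b c d => ⟨Equiv.swap_apply_of_ne_of_ne a b, Equiv.swap_apply_of_ne_of_ne c d⟩
  by_cases x1 : x = i
  · subst x1
    simp [Equiv.swap_apply_of_ne_of_ne, *, Ne.symm]
  by_cases x2 : x = i'
  · subst x2
    simp [Equiv.swap_apply_of_ne_of_ne, *, Ne.symm]
  by_cases x3 : x = k
  · subst x3
    simp [Equiv.swap_apply_of_ne_of_ne, *, Ne.symm]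
  by_cases x4 : x = l
  · subst x4
    simp [Equiv.swap_apply_of_ne_of_ne, *, Ne.symm]
  rw [(e1 x x1 x2 x3 x4).1, (e1 x x1 x2 x3 x4).2]
  have n1 : π.partner x ≠ i := fun e => x4 (by rw [← h1, ← e, π.partner_partner])
  have n2 : π.partner x ≠ i' := fun e => x3 (by rw [← h2, ← e, π.partner_partner])
  have n3 : π.partner x ≠ k := fun e => x2 (by rw [← h4, ← e, π.partner_partner])
  have n4 : π.partner x ≠ l := fun e => x1 (by rw [← h3, ← e, π.partner_partner])
  rw [(e1 _ n1 n2 n3 n4).1, (e1 _ n1 n2 n3 n4).2]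

/-- The excluded configuration is the nested one, where both pairs of ends belong to the same two
strands: the first exchange then already makes them cross. -/
theorem Tangle.split_exchange_of_ne {π : Tangle m} {i i' k l : Fin (2 * m)}
    (hi : i.val + 1 = i'.val) (h : π.Split k l)
    (hik : i ≠ k) (hil : i ≠ l) (hjk : i' ≠ k) (hjl : i' ≠ l)
    (hn : ¬ (π.partner l = i ∧ π.partner k = i')) :
    (π.exchange i i').Split k l ∧ ((π.exchange i i').Diverge k l ↔ π.Diverge k l) := by
  obtain ⟨h1, h2, h3⟩ := h
  unfold Tangle.Split Tangle.Diverge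
  rw [π.exchange_of_ne hik.symm hjk.symm, π.exchange_of_ne hil.symm hjl.symm]
  have := π.partner_ne k
  have := π.partner_ne l
  have : π.partner k ≠ π.partner l := fun e => by
    rw [π.partner_inj.1 e] at h1; omega
  generalize π.partner k = a at *
  generalize π.partner l = c at *
  simp only [Equiv.swap_apply_def]
  simp only [Fin.lt_def, ne_eq, Fin.ext_iff] at *
  split_ifs <;> omega

/-- Among three adjacent, pairwise non-crossing strands those running left precede those running
right, so at most one gap diverges. The equivalences record the signs of the six moves along both
sides of the braid relation. -/
theorem Tangle.Split.hexagon {π : Tangle m} {i j k : Fin (2 * m)} (h1 : π.Split i j)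
    (h2 : π.Split j k) :
    ((π.exchange i j).Split j k ∧ ((π.exchange i j).exchange j k).Split i j ∧
    (π.exchange j k).Split i j ∧ ((π.exchange j k).exchange i j).Split j k) ∧
    (((π.exchange i j).exchange j k).Diverge i j ↔ π.Diverge j k) ∧
    (((π.exchange j k).exchange i j).Diverge j k ↔ π.Diverge i j) ∧
    ((π.exchange i j).Diverge j k ↔ (π.exchange j k).Diverge i j) ∧
    ((π.exchange i j).Diverge j k ↔ π.Diverge i j ∨ π.Diverge j k) ∧
    (π.Diverge i j → π.Diverge j k → False) := by
  have c1 := h1.partner_right_ne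
  have c2 := h2.partner_right_ne
  have c3 := π.partner_ne i
  have c4 := π.partner_ne j
  have c5 := π.partner_ne k
  obtain ⟨a1, a2, a3⟩ := h1
  obtain ⟨b1, b2, b3⟩ := h2
  have d1 : π.partner i ≠ k := fun e => by
    have : π.partner k = i := by rw [← e, π.partner_partner]
    rw [this] at b3
    simp only [Fin.lt_def, ne_eq, Fin.ext_iff] at *
    omega
  have d2 : π.partner k ≠ i := fun e => d1 (by rw [← e, π.partner_partner])
  have n1 : k ≠ i := by simp only [ne_eq, Fin.ext_iff]; omega
  have n2 : k ≠ j := by simp only [ne_eq, Fin.ext_iff]; omega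
  have n3 : i ≠ j := by simp only [ne_eq, Fin.ext_iff]; omega
  have p1 : (π.exchange i j).partner i = π.partner j := π.exchange_left a2
  have p2 : (π.exchange i j).partner j = π.partner i := π.exchange_right a2
  have p3 : (π.exchange i j).partner k = π.partner k := by
    rw [π.exchange_of_ne n1 n2, Equiv.swap_apply_of_ne_of_ne d2 c2]
  have q1 : (π.exchange j k).partner j = π.partner k := π.exchange_left b2
  have q2 : (π.exchange j k).partner k = π.partner j := π.exchange_right b2
  have q3 : (π.exchange j k).partner i = π.partner i := by
    rw [π.exchange_of_ne n3 n1.symm, Equiv.swap_apply_of_ne_of_ne a2 d1]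
  have r1 : ((π.exchange i j).exchange j k).partner j = π.partner k := by
    rw [Tangle.exchange_left _ (by rw [p2]; exact d1), p3]
  have r3 : ((π.exchange i j).exchange j k).partner i = π.partner j := by
    rw [Tangle.exchange_of_ne _ n3 n1.symm, p1, Equiv.swap_apply_of_ne_of_ne c4 b2]
  have s1 : ((π.exchange j k).exchange i j).partner j = π.partner i := by
    rw [Tangle.exchange_right _ (by rw [q3]; exact a2), q3]
  have s3 : ((π.exchange j k).exchange i j).partner k = π.partner j := by
    rw [Tangle.exchange_of_ne _ n1 n2, q2, Equiv.swap_apply_of_ne_of_ne c1 c4]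
  unfold Tangle.Split Tangle.Diverge
  rw [p2, p3, q3, q1, r1, r3, s1, s3]
  clear p1 p2 p3 q1 q2 q3 r1 r3 s1 s3
  generalize π.partner i = x at *
  generalize π.partner j = y at *
  generalize π.partner k = z at *
  simp only [Fin.lt_def, ne_eq, Fin.ext_iff] at *
  refine ⟨?_, ?_, ?_, ?_, ?_, ?_⟩ <;> omega

theorem Tangle.Split.ne {π : Tangle m} {i j : Fin (2 * m)} (h : π.Split i j) : i ≠ j := by
  have := h.1
  simp only [ne_eq, Fin.ext_iff]; omega

/-- A third strand, ending just right of a parallel pair, is pulled across both strands. Both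
crossings have the same sign, and the pair reappears shifted by one point at this end. -/
theorem Tangle.parallel_split_right {π : Tangle m} {i i' i'' j j' : Fin (2 * m)}
    (hi : i.val + 1 = i'.val) (hj : j.val + 1 = j'.val) (h1 : π.partner i = j)
    (h2 : π.partner i' = j') (hs : π.Split i' i'') :
    ((π.exchange i' i'').Split i i' ∧
      ((π.exchange i' i'').Diverge i i' ↔ π.Diverge i' i'')) ∧
    (((π.exchange i' i'').exchange i i').partner i' = j ∧
      ((π.exchange i' i'').exchange i i').partner i'' = j') ∧
    i'' ≠ j ∧ i'' ≠ j' := by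
  have c1 := hs.partner_right_ne
  have c3 := π.partner_ne i
  have c4 := π.partner_ne i'
  have c5 := π.partner_ne i''
  have n0 := hs.ne
  obtain ⟨b1, b2, b3⟩ := hs
  have n1 : i ≠ i' := by simp only [ne_eq, Fin.ext_iff]; omega
  have n2 : i ≠ i'' := by simp only [ne_eq, Fin.ext_iff]; omega
  have h3 : π.partner j = i := by rw [← h1, π.partner_partner]
  have h4 : π.partner j' = i' := by rw [← h2, π.partner_partner]
  rw [h2] at b2 b3 c4
  rw [h1] at c3
  have a2 : i'' ≠ j := fun e => by
    rw [e, h3] at b3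
    rw [e] at b1
    simp only [Fin.lt_def] at b3
    omega
  have a1 : j ≠ i' := fun e => by
    rw [e, h2] at h3
    rw [h3, e] at hj; omega
  have d1 : π.partner i'' ≠ j := fun e => n2 (π.partner_inj.1 (h1.trans e.symm))
  have d2 : π.partner i'' ≠ j' := fun e => n0 (π.partner_inj.1 (h2.trans e.symm))
  have d3 : π.partner i'' ≠ i := fun e => a2 (by rw [← h1, ← e, π.partner_partner])
  have d4 : j' ≠ i := fun e => by
    rw [e] at h2
    have := h4; rw [e, h1] at this; exact a1 this
  have q1 : (π.exchange i' i'').partner i' = π.partner i'' := π.exchange_left (by rw [h2]; exact b2)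
  have q2 : (π.exchange i' i'').partner i'' = j' := by
    rw [π.exchange_right (by rw [h2]; exact b2), h2]
  have q3 : (π.exchange i' i'').partner i = j := by
    rw [π.exchange_of_ne n1 n2, h1, Equiv.swap_apply_of_ne_of_ne a1 a2.symm]
  have s1 : ((π.exchange i' i'').exchange i i').partner i' = j := by
    rw [Tangle.exchange_right _ (by rw [q3]; exact a1), q3]
  have s3 : ((π.exchange i' i'').exchange i i').partner i'' = j' := by
    rw [Tangle.exchange_of_ne _ n2.symm n0.symm, q2, Equiv.swap_apply_of_ne_of_ne d4 c4]
  refine ⟨?_, ⟨s1, s3⟩, a2, b2.symm⟩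
  unfold Tangle.Split Tangle.Diverge
  rw [q1, q3, h2]
  generalize π.partner i'' = z at *
  clear h1 h2 h3 h4 q1 q2 q3 s1 s3
  simp only [Fin.lt_def, ne_eq, Fin.ext_iff] at *
  refine ⟨?_, ?_⟩ <;> omega

theorem Tangle.parallel_split_left {π : Tangle m} {h i i' j j' : Fin (2 * m)}
    (hi : i.val + 1 = i'.val) (hj : j.val + 1 = j'.val) (h1 : π.partner i = j)
    (h2 : π.partner i' = j') (hs : π.Split h i) :
    ((π.exchange h i).Split i i' ∧
      ((π.exchange h i).Diverge i i' ↔ π.Diverge h i)) ∧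
    (((π.exchange h i).exchange i i').partner h = j ∧
      ((π.exchange h i).exchange i i').partner i = j') ∧
    h ≠ j ∧ h ≠ j' := by
  have c1 := hs.partner_right_ne
  have c3 := π.partner_ne i
  have c4 := π.partner_ne i'
  have c5 := π.partner_ne h
  have n0 := hs.ne
  obtain ⟨b1, b2, b3⟩ := hs
  have n1 : i ≠ i' := by simp only [ne_eq, Fin.ext_iff]; omega
  have n2 : h ≠ i' := by simp only [ne_eq, Fin.ext_iff]; omega
  have h3 : π.partner j = i := by rw [← h1, π.partner_partner]
  have h4 : π.partner j' = i' := by rw [← h2, π.partner_partner]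
  rw [h1] at b3 c1 c3
  rw [h2] at c4
  have a1 : j ≠ i' := fun e => by
    rw [e, h2] at h3
    rw [h3, e] at hj; omega
  have d4 : j' ≠ i := fun e => by
    rw [e] at h2
    have := h4; rw [e, h1] at this; exact a1 this
  have a2 : h ≠ j' := fun e => by
    rw [e, h4] at b3
    rw [e] at b1
    simp only [Fin.lt_def] at b3
    omega
  have d1 : π.partner h ≠ j := fun e => n0 (π.partner_inj.1 (e.trans h1.symm))
  have d2 : π.partner h ≠ j' := fun e => n2 (π.partner_inj.1 (e.trans h2.symm))
  have d3 : π.partner h ≠ i' := fun e => a2 (by rw [← h2, ← e, π.partner_partner])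
  have q1 : (π.exchange h i).partner h = j := by rw [π.exchange_left b2, h1]
  have q2 : (π.exchange h i).partner i = π.partner h := π.exchange_right b2
  have q3 : (π.exchange h i).partner i' = j' := by
    rw [π.exchange_of_ne n2.symm n1.symm, h2, Equiv.swap_apply_of_ne_of_ne a2.symm d4]
  have s1 : ((π.exchange h i).exchange i i').partner i = j' := by
    rw [Tangle.exchange_left _ (by rw [q2]; exact d3), q3]
  have s3 : ((π.exchange h i).exchange i i').partner h = j := by
    rw [Tangle.exchange_of_ne _ n0 n2, q1, Equiv.swap_apply_of_ne_of_ne c3 a1]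
  refine ⟨?_, ⟨s3, s1⟩, c1.symm, a2⟩
  unfold Tangle.Split Tangle.Diverge
  rw [q2, q3, h1]
  generalize π.partner h = z at *
  clear h1 h2 h3 h4 q1 q2 q3 s1 s3
  simp only [Fin.lt_def, ne_eq, Fin.ext_iff] at *
  refine ⟨?_, ?_⟩ <;> omega

end Combinatorics

/-! ### Confluence: uniqueness for any operators satisfying the braid relations. -/

section Confluence

/-- Operators indexed by pairs of points that satisfy the braid relations, and a base vector for
`ρ` on which the operators removing the same crossing from both sides agree. -/
structure BraidAction (m : ℕ) [NeZero m] (V : Type*) where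
  op : Fin (2 * m) → Fin (2 * m) → Equiv.Perm V
  base : V
  braid : ∀ i j k, i ≠ j → i ≠ k → j ≠ k →
    op i j * op j k * op i j = op j k * op i j * op j k
  comm : ∀ i j k l, i ≠ j → i ≠ k → i ≠ l → j ≠ k → j ≠ l → k ≠ l →
    op i j * op k l = op k l * op i j
  -- For Hecke operators this holds because the inverse differs from the operator by a scalar that
  -- is the same for all pairs.
  inv_eq : ∀ i j k l v, i ≠ j → k ≠ l → op i j v = op k l v → (op i j)⁻¹ v = (op k l)⁻¹ v
  parallel : ∀ i i' j j' : Fin (2 * m), i.val + 1 = i'.val → j.val + 1 = j'.val →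
    (Tangle.rho m).partner i = j → (Tangle.rho m).partner i' = j' →
      op i i' base = op j j' base

variable {m : ℕ} [NeZero m] {V : Type*} (A : BraidAction m V)

namespace BraidAction

open Classical in
/-- The operator which removes a crossing at `i, j` and results in `π`. -/
noncomputable def removal (π : Tangle m) (i j : Fin (2 * m)) : Equiv.Perm V :=
  if π.Diverge i j then A.op i j else (A.op i j)⁻¹

/-- `v` is obtained from the base vector along moves from `ρ` to `π`. -/
inductive Reach : Tangle m → V → Prop
  | rho : Reach (Tangle.rho m) A.base
  | step {π : Tangle m} {v : V} {i j : Fin (2 * m)} : Reach (π.exchange i j) v → π.Split i j →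
      Reach π (A.removal π i j v)

theorem Reach.pos {π : Tangle m} {v : V} {i j : Fin (2 * m)} (h : A.Reach π v)
    (hu : π.UntwistPos i j) : A.Reach (π.exchange i j) (A.op i j v) := by
  have := hu.split_exchange
  have h2 := Reach.step (A := A) (π := π.exchange i j) (v := v) (i := i) (j := j) (by simpa using h)
    this.1
  rwa [removal, if_pos this.2] at h2

theorem Reach.inv {π : Tangle m} {v : V} {i j : Fin (2 * m)} (h : A.Reach π v)
    (hu : π.UntwistInv i j) : A.Reach (π.exchange i j) ((A.op i j)⁻¹ v) := by
  have := hu.split_exchange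
  have h2 := Reach.step (A := A) (π := π.exchange i j) (v := v) (i := i) (j := j) (by simpa using h)
    this.1
  rwa [removal, if_neg this.2] at h2

end BraidAction

theorem Tangle.rankInduction {P : Tangle m → Prop} (h0 : P (Tangle.rho m))
    (hs : ∀ π i j, π.Split i j → P (π.exchange i j) → P π) (π : Tangle m) : P π := by
  induction h : π.rank using Nat.strong_induction_on generalizing π with
  | _ n ih =>
    by_cases hc : ∃ i j, π.Split i j
    · obtain ⟨i, j, hij⟩ := hc
      exact hs π i j hij (ih _ (h ▸ hij.rank_exchange_lt) _ rfl)
    · push Not at hc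
      rw [Tangle.eq_rho hc]; exact h0

theorem BraidAction.exists_reach (π : Tangle m) : ∃ v, A.Reach π v := by
  induction π using Tangle.rankInduction with
  | h0 => exact ⟨_, .rho⟩
  | hs π i j hij ih => obtain ⟨v, hv⟩ := ih; exact ⟨_, .step hv hij⟩

namespace BraidAction

variable {A}

theorem removal_of_diverge {π : Tangle m} {i j : Fin (2 * m)} (h : π.Diverge i j) :
    A.removal π i j = A.op i j := if_pos h

theorem removal_of_not_diverge {π : Tangle m} {i j : Fin (2 * m)} (h : ¬ π.Diverge i j) :
    A.removal π i j = (A.op i j)⁻¹ := if_neg h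

theorem removal_congr {π π' : Tangle m} {i j : Fin (2 * m)} (h : π.Diverge i j ↔ π'.Diverge i j) :
    A.removal π i j = A.removal π' i j := by
  by_cases h' : π.Diverge i j
  · rw [removal_of_diverge h', removal_of_diverge (h.1 h')]
  · rw [removal_of_not_diverge h', removal_of_not_diverge (fun e => h' (h.2 e))]

theorem removal_comm (π π' : Tangle m) {i j k l : Fin (2 * m)} (hij : i ≠ j) (hik : i ≠ k)
    (hil : i ≠ l) (hjk : j ≠ k) (hjl : j ≠ l) (hkl : k ≠ l) :
    Commute (A.removal π i j) (A.removal π' k l) := by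
  have h : Commute (A.op i j) (A.op k l) := A.comm i j k l hij hik hil hjk hjl hkl
  unfold removal
  split_ifs
  · exact h
  · exact h.inv_right
  · exact h.inv_left
  · exact h.inv_left.inv_right

theorem op_removal_comm (π : Tangle m) {i j k l : Fin (2 * m)} (hij : i ≠ j) (hik : i ≠ k)
    (hil : i ≠ l) (hjk : j ≠ k) (hjl : j ≠ l) (hkl : k ≠ l) :
    Commute (A.op i j) (A.removal π k l) := by
  have h : Commute (A.op i j) (A.op k l) := A.comm i j k l hij hik hil hjk hjl hkl
  unfold removal
  split_ifs
  · exact h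
  · exact h.inv_right

theorem braid_relations {G : Type*} [Group G] {s t : G} (h : s * t * s = t * s * t) :
    s * t⁻¹ * s⁻¹ = t⁻¹ * s⁻¹ * t ∧
    s * t * s⁻¹ = t⁻¹ * s * t ∧ t * s * t⁻¹ = s⁻¹ * t * s ∧
    s⁻¹ * t⁻¹ * s⁻¹ = t⁻¹ * s⁻¹ * t⁻¹ := by
  refine ⟨?_, ?_, ?_, ?_⟩
  · rw [eq_comm, ← mul_right_inj (s * t), ← mul_left_inj (s * t)]
    simp only [mul_assoc, mul_inv_cancel_left, inv_mul_cancel_left, inv_mul_cancel, mul_one] at h ⊢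
    exact h.symm
  · rw [eq_comm, ← mul_right_inj t, ← mul_left_inj s]
    simp only [mul_assoc, mul_inv_cancel_left, inv_mul_cancel, mul_one] at h ⊢
    exact h
  · rw [eq_comm, ← mul_right_inj s, ← mul_left_inj t]
    simp only [mul_assoc, mul_inv_cancel_left, inv_mul_cancel, mul_one] at h ⊢
    exact h.symm
  · have := congrArg (fun x => x⁻¹) h
    simpa [mul_assoc] using this

/-- Uniqueness of the vector of a tangle, together with the agreement of the operators which
remove the crossing of two parallel strands from both sides. -/
def Coherent (A : BraidAction m V) (π : Tangle m) : Prop :=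
  (∀ v w, A.Reach π v → A.Reach π w → v = w) ∧
  ∀ i i' j j' : Fin (2 * m), i.val + 1 = i'.val → j.val + 1 = j'.val →
    π.partner i = j → π.partner i' = j' → ∀ v, A.Reach π v → A.op i i' v = A.op j j' v

theorem Reach.cases_split {π : Tangle m} {v : V} (h : A.Reach π v) :
    (π = Tangle.rho m ∧ v = A.base) ∨
      ∃ i j w, π.Split i j ∧ A.Reach (π.exchange i j) w ∧ v = A.removal π i j w := by
  cases h with
  | rho => exact Or.inl ⟨rfl, rfl⟩
  | step h hs => exact Or.inr ⟨_, _, _, hs, h, rfl⟩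

/-- The diamond step: uniqueness at lower rank allows `v` and `w` to be rewritten as images of a
vector of a common ancestor, and a relation between the operators closes the diagram. -/
theorem unique_of_lt {π : Tangle m} (ih : ∀ π' : Tangle m, π'.rank < π.rank → A.Coherent π')
    {i i' k k' : Fin (2 * m)} (hi : π.Split i i') (hk : π.Split k k') (hle : i ≤ k) {v w : V}
    (hv : A.Reach (π.exchange i i') v) (hw : A.Reach (π.exchange k k') w) :
    A.removal π i i' v = A.removal π k k' w := by
  have ui := ih _ hi.rank_exchange_lt
  have uk := ih _ hk.rank_exchange_lt
  have hi1 := hi.1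
  have hk1 := hk.1
  by_cases hik : i = k
  · subst hik
    have : i' = k' := by ext; omega
    subst this
    rw [ui.1 v w hv hw]
  have n1 := hi.ne
  have n2 := hk.ne
  by_cases hjk : i' = k
  · subst hjk
    have n3 : i ≠ k' := by simp only [ne_eq, Fin.ext_iff]; omega
    obtain ⟨⟨s1, s2, s3, s4⟩, d1, d2, d3, d4, d5⟩ := hi.hexagon hk
    obtain ⟨u, hu⟩ := A.exists_reach (((π.exchange i i').exchange i' k').exchange i i')
    have hu' := hu
    rw [Tangle.exchange_braid π n1 n3 n2] at hu'
    have e1 := ui.1 _ _ hv (.step (.step hu s2) s1)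
    have e2 := uk.1 _ _ hw (.step (.step hu' s4) s3)
    rw [e1, e2]
    obtain ⟨-, b3, b4, b5⟩ := braid_relations (A.braid i i' k' n1 n3 n2)
    simp only [← Equiv.Perm.mul_apply, ← mul_assoc]
    congr 1
    -- Of the eight sign patterns only three are possible; each is a form of the braid relation with
    -- some generators inverted.
    by_cases x : π.Diverge i i' <;> by_cases y : π.Diverge i' k' <;>
      by_cases z : (π.exchange i i').Diverge i' k'
    · exact (d5 x y).elim
    · exact (d5 x y).elim
    · rw [removal_of_diverge x, removal_of_diverge z, removal_of_not_diverge (mt d1.1 y),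
        removal_of_not_diverge y, removal_of_diverge (d3.1 z), removal_of_diverge (d2.2 x)]
      exact b3
    · exact (z (d4.2 (.inl x))).elim
    · rw [removal_of_not_diverge x, removal_of_diverge z, removal_of_diverge (d1.2 y),
        removal_of_diverge y, removal_of_diverge (d3.1 z), removal_of_not_diverge (mt d2.1 x)]
      exact b4.symm
    · exact (z (d4.2 (.inr y))).elim
    · exact ((d4.1 z).elim x y).elim
    · rw [removal_of_not_diverge x, removal_of_not_diverge z, removal_of_not_diverge (mt d1.1 y),
        removal_of_not_diverge y, removal_of_not_diverge (mt d3.2 z),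
        removal_of_not_diverge (mt d2.1 x)]
      exact b5
  · have hlt : i'.val < k.val := by
      simp only [Fin.le_def, Fin.ext_iff] at *; omega
    have m1 : i ≠ k' := by simp only [ne_eq, Fin.ext_iff]; omega
    have m2 : i' ≠ k' := by simp only [ne_eq, Fin.ext_iff]; omega
    -- Nested strands: both exchanges give one tangle, in which the two strands are parallel. Its
    -- coherence equates the two operators on `v`; neither pair diverges in `π`, so their inverses
    -- are what is needed.
    by_cases hn : π.partner i = k' ∧ π.partner i' = k
    · have heq := π.exchange_eq_of_nested n1 n2 hik m1 hjk m2 hn.1 hn.2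
      rw [← heq] at hw
      rw [ui.1 w v hw hv]
      have hp : A.op i i' v = A.op k k' v := by
        refine ui.2 i i' k k' hi1 hk1 ?_ ?_ v hv
        · rw [π.exchange_left hi.2.1]; exact hn.2
        · rw [π.exchange_right hi.2.1]; exact hn.1
      have h3 : π.partner k' = i := by rw [← hn.1, π.partner_partner]
      have h4 : π.partner k = i' := by rw [← hn.2, π.partner_partner]
      unfold removal
      rw [if_neg, if_neg]
      · exact A.inv_eq _ _ _ _ _ n1 n2 hp
      · rintro ⟨-, h⟩; rw [h3] at h; simp only [Fin.lt_def] at h; omega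
      · rintro ⟨h, -⟩; rw [hn.1] at h; simp only [Fin.lt_def] at h; omega
    · obtain ⟨a1, a2⟩ := Tangle.split_exchange_of_ne hi1 hk hik m1 hjk m2 (fun h => hn
        ⟨by rw [← h.1, π.partner_partner], by rw [← h.2, π.partner_partner]⟩)
      obtain ⟨b1, b2⟩ := Tangle.split_exchange_of_ne hk1 hi (Ne.symm hik) (Ne.symm hjk) m1.symm
        m2.symm (fun h => hn ⟨h.2, h.1⟩)
      obtain ⟨u, hu⟩ := A.exists_reach ((π.exchange i i').exchange k k')
      have hu' := hu
      rw [Tangle.exchange_comm π hik m1 hjk m2] at hu'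
      rw [ui.1 _ _ hv (.step hu a1), uk.1 _ _ hw (.step hu' b1), removal_congr a2,
        removal_congr b2]
      simp only [← Equiv.Perm.mul_apply]
      rw [(removal_comm π π n1 hik m1 hjk m2 n2).eq]

/-- The braid relation moves `t` next to `w`, where it may be replaced by `u`, and `u` commutes with
the rest. The two forms serve the two signs of a third strand pulled across the pair. -/
theorem parallel_transport {s t u : Equiv.Perm V} (hb : s * t * s = t * s * t)
    (hs : Commute s u) (ht : Commute t u) {w : V} (hw : t w = u w) :
    s (t (s w)) = u (t (s w)) ∧ s (t⁻¹ (s⁻¹ w)) = u (t⁻¹ (s⁻¹ w)) := by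
  constructor
  · calc s (t (s w)) = (s * t * s) w := rfl
      _ = (t * s) (t w) := by rw [hb]; rfl
      _ = ((t * s) * u) w := by rw [hw]; rfl
      _ = (u * (t * s)) w := by rw [(ht.mul_left hs).eq]
  · calc s (t⁻¹ (s⁻¹ w)) = (s * t⁻¹ * s⁻¹) w := rfl
      _ = (t⁻¹ * s⁻¹) (t w) := by rw [(braid_relations hb).1]; rfl
      _ = ((t⁻¹ * s⁻¹) * u) w := by rw [hw]; rfl
      _ = (u * (t⁻¹ * s⁻¹)) w := by rw [(ht.inv_left.mul_left hs.inv_left).eq]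

/-- Pulling the adjacent strand across the parallel pair lowers the rank twice; agreement for the
shifted pair is carried back by `parallel_transport`. Uniqueness at `π` permits this choice of the
last two moves. -/
theorem coherent_split_adjacent {π : Tangle m}
    (ih : ∀ π' : Tangle m, π'.rank < π.rank → A.Coherent π')
    (hu : ∀ v w, A.Reach π v → A.Reach π w → v = w)
    {i i' j j' : Fin (2 * m)} (hi : i.val + 1 = i'.val) (hj : j.val + 1 = j'.val)
    (h1 : π.partner i = j) (h2 : π.partner i' = j')
    (hs : (∃ k, π.Split i' k) ∨ ∃ h, π.Split h i) {v : V} (hv : A.Reach π v) :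
    A.op i i' v = A.op j j' v := by
  have nij : i ≠ j := fun e => π.partner_ne i (by rw [h1, e])
  have nij' : i' ≠ j' := fun e => π.partner_ne i' (by rw [h2, e])
  have nii : i ≠ i' := by simp only [ne_eq, Fin.ext_iff]; omega
  have njj : j ≠ j' := by simp only [ne_eq, Fin.ext_iff]; omega
  have h3 : π.partner j = i := by rw [← h1, π.partner_partner]
  have n1 : i' ≠ j := fun e => by
    rw [← e, h2] at h3
    rw [h3, ← e] at hj; omega
  have n2 : i ≠ j' := fun e => by
    have h4 := π.partner_partner i'
    rw [h2, ← e, h1] at h4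
    exact n1 h4.symm
  have cij := A.comm i i' j j' nii nij n2 n1 nij' njj
  obtain ⟨k, hs⟩ | ⟨k, hs⟩ := hs
  · obtain ⟨⟨s1, d1⟩, ⟨p1, p2⟩, m1, m2⟩ := Tangle.parallel_split_right hi hj h1 h2 hs
    obtain ⟨w, hw⟩ := A.exists_reach ((π.exchange i' k).exchange i i')
    rw [hu v _ hv (.step (.step hw s1) hs)]
    have hk := hs.1
    have hp := (ih _ (s1.rank_exchange_lt.trans hs.rank_exchange_lt)).2 i' k j j' hk hj p1 p2 w hw
    have hik : i ≠ k := by simp only [ne_eq, Fin.ext_iff]; omega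
    have := parallel_transport (A.braid i i' k nii hik hs.ne) cij
      (A.comm i' k j j' hs.ne n1 nij' m1 m2 njj) hp
    by_cases x : π.Diverge i' k
    · rw [removal_of_diverge x, removal_of_diverge (d1.2 x)]; exact this.1
    · rw [removal_of_not_diverge x, removal_of_not_diverge (mt d1.1 x)]; exact this.2
  · obtain ⟨⟨s1, d1⟩, ⟨p1, p2⟩, m1, m2⟩ := Tangle.parallel_split_left hi hj h1 h2 hs
    obtain ⟨w, hw⟩ := A.exists_reach ((π.exchange k i).exchange i i')
    rw [hu v _ hv (.step (.step hw s1) hs)]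
    have hk := hs.1
    have hp := (ih _ (s1.rank_exchange_lt.trans hs.rank_exchange_lt)).2 k i j j' hk hj p1 p2 w hw
    have hik : k ≠ i' := by simp only [ne_eq, Fin.ext_iff]; omega
    have := parallel_transport (A.braid k i i' hs.ne hik nii).symm cij
      (A.comm k i j j' hs.ne m1 m2 nij n2 njj) hp
    by_cases x : π.Diverge k i
    · rw [removal_of_diverge x, removal_of_diverge (d1.2 x)]; exact this.1
    · rw [removal_of_not_diverge x, removal_of_not_diverge (mt d1.1 x)]; exact this.2

theorem coherent (π : Tangle m) : A.Coherent π := by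
  induction h : π.rank using Nat.strong_induction_on generalizing π with
  | _ n ih =>
    have ih' : ∀ π' : Tangle m, π'.rank < π.rank → A.Coherent π' :=
      fun π' h' => ih _ (h ▸ h') π' rfl
    clear ih h
    have hu : ∀ v w, A.Reach π v → A.Reach π w → v = w := by
      intro v w hv hw
      rcases hv.cases_split with ⟨e, rfl⟩ | ⟨i, i', v', hi, hv', rfl⟩
      · subst e
        rcases hw.cases_split with ⟨-, rfl⟩ | ⟨k, k', w', hk, -, -⟩
        · rfl
        · exact (Tangle.not_split_rho _ _ hk).elim
      · rcases hw.cases_split with ⟨rfl, -⟩ | ⟨k, k', w', hk, hw', rfl⟩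
        · exact (Tangle.not_split_rho _ _ hi).elim
        · rcases le_total i k with hik | hik
          · exact unique_of_lt ih' hi hk hik hv' hw'
          · exact (unique_of_lt ih' hk hi hik hw' hv').symm
    refine ⟨hu, fun i i' j j' hi hj h1 h2 v hv => ?_⟩
    rcases hv.cases_split with ⟨rfl, rfl⟩ | ⟨k, k', w, hk, hw, rfl⟩
    · exact A.parallel i i' j j' hi hj h1 h2
    have h3 : π.partner j = i := by rw [← h1, π.partner_partner]
    have h4 : π.partner j' = i' := by rw [← h2, π.partner_partner]
    -- A last move sharing one end with the parallel pair falls under the adjacent case. It cannot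
    -- act on both strands of the pair, since these cross; otherwise it is disjoint from both pairs
    -- of ends and commutes with both operators.
    by_cases c1 : k = i'
    · subst c1; exact coherent_split_adjacent ih' hu hi hj h1 h2 (.inl ⟨_, hk⟩) hv
    by_cases c2 : k' = i
    · subst c2; exact coherent_split_adjacent ih' hu hi hj h1 h2 (.inr ⟨_, hk⟩) hv
    by_cases c3 : k = j'
    · subst c3; exact (coherent_split_adjacent ih' hu hj hi h3 h4 (.inl ⟨_, hk⟩) hv).symm
    by_cases c4 : k' = j
    · subst c4; exact (coherent_split_adjacent ih' hu hj hi h3 h4 (.inr ⟨_, hk⟩) hv).symm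
    have c5 : k ≠ i := fun e => by
      subst e
      have e2 : k' = i' := by ext; have := hk.1; omega
      subst e2
      have := hk.2.2
      rw [h1, h2] at this
      simp only [Fin.lt_def] at this; omega
    have c6 : k ≠ j := fun e => by
      subst e
      have e2 : k' = j' := by ext; have := hk.1; omega
      subst e2
      have := hk.2.2
      rw [h3, h4] at this
      simp only [Fin.lt_def] at this; omega
    have c7 : k' ≠ i' := fun e => by
      subst e; exact c5 (by ext; have := hk.1; omega)
    have c8 : k' ≠ j' := fun e => by
      subst e; exact c6 (by ext; have := hk.1; omega)
    have nii : i ≠ i' := by simp only [ne_eq, Fin.ext_iff]; omega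
    have njj : j ≠ j' := by simp only [ne_eq, Fin.ext_iff]; omega
    have hp := (ih' _ hk.rank_exchange_lt).2 i i' j j' hi hj
      (by rw [π.exchange_of_ne (Ne.symm c5) (Ne.symm c2), h1,
        Equiv.swap_apply_of_ne_of_ne (Ne.symm c6) (Ne.symm c4)])
      (by rw [π.exchange_of_ne (Ne.symm c1) (Ne.symm c7), h2,
        Equiv.swap_apply_of_ne_of_ne (Ne.symm c3) (Ne.symm c8)]) w hw
    simp only [← Equiv.Perm.mul_apply]
    rw [(op_removal_comm π nii (Ne.symm c5) (Ne.symm c2) (Ne.symm c1) (Ne.symm c7) hk.ne).eq,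
      (op_removal_comm π njj (Ne.symm c6) (Ne.symm c4) (Ne.symm c3) (Ne.symm c8) hk.ne).eq]
    simp only [Equiv.Perm.mul_apply, hp]

end BraidAction

end Confluence

/-! ### Hecke relations for Demazure–Lusztig operators and their twists. -/

section Hecke

variable {F : Type*} [Field F]

/-- The Demazure–Lusztig operator. -/
def demazureLusztig (P x y : F) (s : F ≃+* F) (v : F) : F :=
  (P * x - P⁻¹ * y) / (x - y) * (v - s v) - P⁻¹ * v

/-- The operator `t̄` on all rational functions. -/
def heckeFun (P Q x y : F) (s : F ≃+* F) (v : F) : F :=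
  (P * x - P⁻¹ * y) / (x - y) * (v - (Q * x - Q⁻¹ * y) / (Q * y - Q⁻¹ * x) * s v) - P⁻¹ * v

/-- Any `D` with this value of D / s(D) conjugates one operator into the other, so relations
transfer. The choice D = Qx − Q⁻¹y recovers t̄; a more symmetric `D` can serve several operators at
once. -/
theorem heckeFun_mul {P Q x y : F} {s : F ≃+* F} {D : F} (h0 : Q * y - Q⁻¹ * x ≠ 0)
    (hD : (Q * x - Q⁻¹ * y) * s D = (Q * y - Q⁻¹ * x) * D) (v : F) :
    heckeFun P Q x y s (D * v) = D * demazureLusztig P x y s v := by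
  unfold heckeFun demazureLusztig
  have : (Q * x - Q⁻¹ * y) / (Q * y - Q⁻¹ * x) * s (D * v) = D * s v := by
    rw [map_mul, div_mul_eq_mul_div, ← mul_assoc, hD, div_eq_iff h0]
    ring
  rw [this]; ring

theorem demazureLusztig_quadratic {P x y : F} {s : F ≃+* F} (hP : P ≠ 0) (hxy : x ≠ y)
    (sP : s P = P) (sx : s x = y) (sy : s y = x) (ss : ∀ v, s (s v) = v) (v : F) :
    demazureLusztig P x y s (demazureLusztig P x y s v) =
      (P - P⁻¹) * demazureLusztig P x y s v + v := by
  have h1 : x - y ≠ 0 := sub_ne_zero.2 hxy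
  have h2 : y - x ≠ 0 := sub_ne_zero.2 hxy.symm
  unfold demazureLusztig
  simp only [map_sub, map_mul, map_div₀, map_inv₀, sP, sx, sy, ss]
  rw [← neg_sub x y, div_neg]
  field_simp
  ring

theorem demazureLusztig_eq {P x y : F} {s : F ≃+* F} (hxy : x ≠ y) (v : F) :
    demazureLusztig P x y s v =
      (P - P⁻¹) * x / (x - y) * v + (P⁻¹ * y - P * x) / (x - y) * s v := by
  have h1 : x - y ≠ 0 := sub_ne_zero.2 hxy
  unfold demazureLusztig
  field_simp
  ring

theorem demazureLusztig_braid {P x y z : F} {s t : F ≃+* F} (hP : P ≠ 0) (hxy : x ≠ y)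
    (hxz : x ≠ z) (hyz : y ≠ z) (sP : s P = P) (tP : t P = P) (sx : s x = y) (sy : s y = x)
    (sz : s z = z) (tx : t x = x) (ty : t y = z) (tz : t z = y) (ss : ∀ v, s (s v) = v)
    (tt : ∀ v, t (t v) = v) (st : ∀ v, s (t (s v)) = t (s (t v))) (v : F) :
    demazureLusztig P x y s (demazureLusztig P y z t (demazureLusztig P x y s v)) =
      demazureLusztig P y z t (demazureLusztig P x y s (demazureLusztig P y z t v)) := by
  have h1 : x - y ≠ 0 := sub_ne_zero.2 hxy
  have h2 : x - z ≠ 0 := sub_ne_zero.2 hxz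
  have h3 : y - z ≠ 0 := sub_ne_zero.2 hyz
  simp only [demazureLusztig_eq hxy, demazureLusztig_eq hyz]
  simp only [map_sub, map_add, map_mul, map_div₀, map_inv₀, sP, sx, sy, sz, tP, tx, ty, tz, ss, tt,
    st]
  rw [← neg_sub x y, ← neg_sub y z]
  simp only [div_neg]
  -- The six translates of `v` under the symmetric group become independent unknowns, leaving a
  -- rational identity in `P`, `x`, `y`, `z`.
  generalize s (t v) = v1
  generalize t (s v) = v2
  generalize t (s (t v)) = v3
  generalize s v = v4
  generalize t v = v5
  field_simp
  ring

theorem heckeFun_quadratic {P Q x y : F} {s : F ≃+* F} (hP : P ≠ 0) (hxy : x ≠ y)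
    (g1 : Q * x - Q⁻¹ * y ≠ 0) (g2 : Q * y - Q⁻¹ * x ≠ 0)
    (sP : s P = P) (sQ : s Q = Q) (sx : s x = y) (sy : s y = x) (ss : ∀ v, s (s v) = v) (v : F) :
    heckeFun P Q x y s (heckeFun P Q x y s v) = (P - P⁻¹) * heckeFun P Q x y s v + v := by
  obtain ⟨w, rfl⟩ : ∃ w, v = (Q * x - Q⁻¹ * y) * w :=
    ⟨v / (Q * x - Q⁻¹ * y), by rw [← mul_div_assoc, mul_div_cancel_left₀ _ g1]⟩
  have hD : (Q * x - Q⁻¹ * y) * s (Q * x - Q⁻¹ * y) = (Q * y - Q⁻¹ * x) * (Q * x - Q⁻¹ * y) := by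
    simp only [map_sub, map_mul, map_inv₀, sQ, sx, sy]; ring
  rw [heckeFun_mul g2 hD, heckeFun_mul g2 hD, demazureLusztig_quadratic hP hxy sP sx sy ss]
  ring

theorem heckeFun_braid {P Q x y z : F} {s t : F ≃+* F} (hP : P ≠ 0) (hxy : x ≠ y)
    (hxz : x ≠ z) (hyz : y ≠ z) (g1 : Q * x - Q⁻¹ * y ≠ 0) (g2 : Q * y - Q⁻¹ * x ≠ 0)
    (g3 : Q * y - Q⁻¹ * z ≠ 0) (g4 : Q * z - Q⁻¹ * y ≠ 0) (g5 : Q * x - Q⁻¹ * z ≠ 0)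
    (sP : s P = P) (tP : t P = P) (sQ : s Q = Q) (tQ : t Q = Q) (sx : s x = y) (sy : s y = x)
    (sz : s z = z) (tx : t x = x) (ty : t y = z) (tz : t z = y) (ss : ∀ v, s (s v) = v)
    (tt : ∀ v, t (t v) = v) (st : ∀ v, s (t (s v)) = t (s (t v))) (v : F) :
    heckeFun P Q x y s (heckeFun P Q y z t (heckeFun P Q x y s v)) =
      heckeFun P Q y z t (heckeFun P Q x y s (heckeFun P Q y z t v)) := by
  -- With all three pairs as factors, `D` satisfies the condition of `heckeFun_mul` for `s` and for
  -- `t`.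
  set D := (Q * x - Q⁻¹ * y) * (Q * y - Q⁻¹ * z) * (Q * x - Q⁻¹ * z) with hD
  have hD0 : D ≠ 0 := mul_ne_zero (mul_ne_zero g1 g3) g5
  obtain ⟨w, rfl⟩ : ∃ w, v = D * w := ⟨v / D, by rw [← mul_div_assoc, mul_div_cancel_left₀ _ hD0]⟩
  have h1 : (Q * x - Q⁻¹ * y) * s D = (Q * y - Q⁻¹ * x) * D := by
    simp only [hD, map_sub, map_mul, map_inv₀, sQ, sx, sy, sz]; ring
  have h2 : (Q * y - Q⁻¹ * z) * t D = (Q * z - Q⁻¹ * y) * D := by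
    simp only [hD, map_sub, map_mul, map_inv₀, tQ, tx, ty, tz]; ring
  simp only [heckeFun_mul g2 h1, heckeFun_mul g4 h2]
  rw [demazureLusztig_braid hP hxy hxz hyz sP tP sx sy sz tx ty tz ss tt st]

theorem heckeFun_comm {P Q x y u w : F} {s t : F ≃+* F} (sP : s P = P) (tP : t P = P)
    (sQ : s Q = Q) (tQ : t Q = Q) (su : s u = u) (sw : s w = w) (tx : t x = x) (ty : t y = y)
    (st : ∀ v, s (t v) = t (s v)) (v : F) :
    heckeFun P Q x y s (heckeFun P Q u w t v) = heckeFun P Q u w t (heckeFun P Q x y s v) := by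
  unfold heckeFun
  simp only [map_sub, map_mul, map_div₀, map_inv₀, sP, tP, sQ, tQ, su, sw, tx, ty, st]
  ring

end Hecke

/-! ### The invertible operators t̄ on rational functions. -/

section RationalFunctions

variable (N : Type*) (K : Type*) [Field K] (F : Type*) [Field F] [Algebra (MvPolynomial N K) F]

/-- The variables as rational functions. -/
noncomputable def ratX (i : N) : F :=
  algebraMap (MvPolynomial N K) F (X i)

/-- The constants as rational functions. -/
noncomputable def ratC (c : K) : F :=
  algebraMap (MvPolynomial N K) F (C c)

variable {N K F} in
theorem ratC_inv (c : K) : ratC N K F c⁻¹ = (ratC N K F c)⁻¹ := by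
  have : ∀ c : K, ratC N K F c = ((algebraMap (MvPolynomial N K) F).comp
    (C : K →+* MvPolynomial N K)) c := fun _ => rfl
  rw [this, this, map_inv₀]

variable [IsFractionRing (MvPolynomial N K) F]

/-- A permutation of the variables acting on rational functions. -/
noncomputable def permAct (σ : Equiv.Perm N) : F ≃+* F :=
  IsFractionRing.ringEquivOfRingEquiv (A := MvPolynomial N K) (renameEquiv K σ).toRingEquiv

variable {N K F}

theorem permAct_algebraMap (σ : Equiv.Perm N) (f : MvPolynomial N K) :
    permAct N K F σ (algebraMap (MvPolynomial N K) F f) =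
      algebraMap _ F (rename σ f) := by
  simp [permAct]

theorem permAct_permAct (σ τ : Equiv.Perm N) (v : F) :
    permAct N K F σ (permAct N K F τ v) = permAct N K F (σ * τ) v := by
  obtain ⟨a, c, -, rfl⟩ := IsFractionRing.div_surjective (A := MvPolynomial N K) v
  simp only [map_div₀, permAct_algebraMap, rename_rename]
  rfl

theorem permAct_one (v : F) : permAct N K F (1 : Equiv.Perm N) v = v := by
  obtain ⟨a, c, -, rfl⟩ := IsFractionRing.div_surjective (A := MvPolynomial N K) v
  simp only [map_div₀, permAct_algebraMap, Equiv.Perm.coe_one, rename_id_apply]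

theorem permAct_ratX (σ : Equiv.Perm N) (i : N) :
    permAct N K F σ (ratX N K F i) = ratX N K F (σ i) := by
  simp [ratX, permAct_algebraMap]

theorem permAct_ratC (σ : Equiv.Perm N) (c : K) :
    permAct N K F σ (ratC N K F c) = ratC N K F c := by
  simp [ratC, permAct_algebraMap]

theorem ratC_ne_zero {c : K} (hc : c ≠ 0) : ratC N K F c ≠ 0 := by
  unfold ratC
  rw [Ne, IsFractionRing.to_map_eq_zero_iff]
  simpa using hc

theorem ratX_injective : Function.Injective (ratX N K F) := by
  intro i j h
  exact X_injective (IsFractionRing.injective (MvPolynomial N K) _ h)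

theorem linear_ne_zero {i j : N} (hij : i ≠ j) {c d : K} (hc : c ≠ 0) :
    (C c * X i - C d * X j : MvPolynomial N K) ≠ 0 := by
  classical
  intro h
  have := congrArg (eval (fun k => if k = i then 1 else 0)) h
  simp [hij.symm] at this
  exact hc this

theorem ratLinear_ne_zero {i j : N} (hij : i ≠ j) {c : K} (hc : c ≠ 0) :
    ratC N K F c * ratX N K F i - (ratC N K F c)⁻¹ * ratX N K F j ≠ 0 := by
  rw [← ratC_inv]
  unfold ratC ratX
  rw [← map_mul, ← map_mul, ← map_sub, Ne, IsFractionRing.to_map_eq_zero_iff]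
  exact linear_ne_zero hij hc

variable [DecidableEq N]

theorem swapAct_swapAct (i j : N) (v : F) :
    permAct N K F (Equiv.swap i j) (permAct N K F (Equiv.swap i j) v) = v := by
  rw [permAct_permAct, Equiv.swap_mul_self, permAct_one]

/-- `t̄_{ij}` on rational functions. -/
noncomputable def heckeOpFun (F : Type*) [Field F] [Algebra (MvPolynomial N K) F]
    [IsFractionRing (MvPolynomial N K) F] (p q : K) (i j : N) (v : F) :
    F :=
  heckeFun (ratC N K F p) (ratC N K F q) (ratX N K F i) (ratX N K F j)
    (permAct N K F (Equiv.swap i j)) v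

theorem heckeOpFun_quadratic {p q : K} (hp : p ≠ 0) (hq : q ≠ 0) {i j : N} (hij : i ≠ j)
    (v : F) :
    heckeOpFun F p q i j (heckeOpFun F p q i j v) =
      (ratC N K F p - (ratC N K F p)⁻¹) * heckeOpFun F p q i j v + v :=
  heckeFun_quadratic (ratC_ne_zero hp) (ratX_injective.ne hij) (ratLinear_ne_zero hij hq)
    (ratLinear_ne_zero hij.symm hq) (permAct_ratC _ _) (permAct_ratC _ _)
    (by rw [permAct_ratX, Equiv.swap_apply_left]) (by rw [permAct_ratX, Equiv.swap_apply_right])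
    (swapAct_swapAct i j) v

theorem heckeOpFun_sub (p q : K) (i j : N) (v w : F) :
    heckeOpFun F p q i j (v - w) = heckeOpFun F p q i j v - heckeOpFun F p q i j w := by
  unfold heckeOpFun heckeFun
  rw [map_sub]; ring

theorem heckeOpFun_const_mul (p q : K) (i j : N) (v : F) :
    heckeOpFun F p q i j ((ratC N K F p - (ratC N K F p)⁻¹) * v) =
      (ratC N K F p - (ratC N K F p)⁻¹) * heckeOpFun F p q i j v := by
  unfold heckeOpFun heckeFun
  simp only [map_mul, map_sub, map_inv₀, permAct_ratC]; ring

open Classical in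
/-- The invertible operator `t̄_{ij}` on rational functions. -/
noncomputable def heckeOp (F : Type*) [Field F] [Algebra (MvPolynomial N K) F]
    [IsFractionRing (MvPolynomial N K) F] (p q : K) (i j : N) : Equiv.Perm F :=
  -- The quadratic relation T² = (P − P⁻¹)T + 1 gives T⁻¹ = T − (P − P⁻¹). The identity in the other
  -- case is a mere default.
  if h : p ≠ 0 ∧ q ≠ 0 ∧ i ≠ j then
    { toFun := heckeOpFun F p q i j
      invFun := fun v => heckeOpFun F p q i j v - (ratC N K F p - (ratC N K F p)⁻¹) * v
      left_inv := fun v => by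
        dsimp only
        rw [heckeOpFun_quadratic h.1 h.2.1 h.2.2]; ring
      right_inv := fun v => by
        rw [heckeOpFun_sub, heckeOpFun_const_mul, heckeOpFun_quadratic h.1 h.2.1 h.2.2]; ring }
  else 1

theorem heckeOp_apply {p q : K} (hp : p ≠ 0) (hq : q ≠ 0) {i j : N} (hij : i ≠ j)
    (v : F) : heckeOp F p q i j v = heckeOpFun F p q i j v := by
  unfold heckeOp
  rw [dif_pos ⟨hp, hq, hij⟩]; rfl

theorem heckeOp_inv_apply {p q : K} (hp : p ≠ 0) (hq : q ≠ 0) {i j : N} (hij : i ≠ j)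
    (v : F) :
    (heckeOp F p q i j)⁻¹ v = heckeOp F p q i j v - (ratC N K F p - (ratC N K F p)⁻¹) * v := by
  unfold heckeOp
  rw [dif_pos ⟨hp, hq, hij⟩]; rfl

theorem heckeOp_braid {p q : K} (hp : p ≠ 0) (hq : q ≠ 0) {i j k : N} (hij : i ≠ j) (hik : i ≠ k)
    (hjk : j ≠ k) :
    heckeOp F p q i j * heckeOp F p q j k * heckeOp F p q i j =
      heckeOp F p q j k * heckeOp F p q i j * heckeOp F p q j k := by
  have hc : Equiv.swap i j * (Equiv.swap j k * Equiv.swap i j) =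
      Equiv.swap j k * (Equiv.swap i j * Equiv.swap j k) := by
    ext x
    simp only [Equiv.Perm.mul_apply, Equiv.swap_apply_def]
    split_ifs <;> simp_all
  ext v
  simp only [Equiv.Perm.mul_apply, heckeOp_apply hp hq hij, heckeOp_apply hp hq hjk]
  unfold heckeOpFun
  refine heckeFun_braid (ratC_ne_zero hp) (ratX_injective.ne hij) (ratX_injective.ne hik)
    (ratX_injective.ne hjk) (ratLinear_ne_zero hij hq) (ratLinear_ne_zero hij.symm hq)
    (ratLinear_ne_zero hjk hq) (ratLinear_ne_zero hjk.symm hq) (ratLinear_ne_zero hik hq)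
    (permAct_ratC _ _) (permAct_ratC _ _) (permAct_ratC _ _) (permAct_ratC _ _)
    (by rw [permAct_ratX, Equiv.swap_apply_left]) (by rw [permAct_ratX, Equiv.swap_apply_right])
    (by rw [permAct_ratX, Equiv.swap_apply_of_ne_of_ne hik.symm hjk.symm])
    (by rw [permAct_ratX, Equiv.swap_apply_of_ne_of_ne hij hik])
    (by rw [permAct_ratX, Equiv.swap_apply_left]) (by rw [permAct_ratX, Equiv.swap_apply_right])
    (swapAct_swapAct i j) (swapAct_swapAct j k) (fun v => ?_) v
  simp only [permAct_permAct, hc]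

theorem heckeOp_comm {p q : K} (hp : p ≠ 0) (hq : q ≠ 0) {i j k l : N} (hij : i ≠ j)
    (hik : i ≠ k) (hil : i ≠ l) (hjk : j ≠ k) (hjl : j ≠ l) (hkl : k ≠ l) :
    heckeOp F p q i j * heckeOp F p q k l = heckeOp F p q k l * heckeOp F p q i j := by
  have hc : Equiv.swap i j * Equiv.swap k l = Equiv.swap k l * Equiv.swap i j := by
    ext x
    simp only [Equiv.Perm.mul_apply, Equiv.swap_apply_def]
    split_ifs <;> simp_all
  ext v
  simp only [Equiv.Perm.mul_apply, heckeOp_apply hp hq hij, heckeOp_apply hp hq hkl]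
  unfold heckeOpFun
  refine heckeFun_comm (permAct_ratC _ _) (permAct_ratC _ _) (permAct_ratC _ _) (permAct_ratC _ _)
    (by rw [permAct_ratX, Equiv.swap_apply_of_ne_of_ne hik.symm hjk.symm])
    (by rw [permAct_ratX, Equiv.swap_apply_of_ne_of_ne hil.symm hjl.symm])
    (by rw [permAct_ratX, Equiv.swap_apply_of_ne_of_ne hik hil])
    (by rw [permAct_ratX, Equiv.swap_apply_of_ne_of_ne hjk hjl]) (fun v => ?_) v
  simp only [permAct_permAct, hc]

end RationalFunctions

/-! ### Primality and divisibility of binary linear forms. -/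

section LinearForms

variable {N K : Type*} [Field K]

theorem rename_swap_rename_swap [DecidableEq N] (i j : N) (f : MvPolynomial N K) :
    rename (Equiv.swap i j) (rename (Equiv.swap i j) f) = f := by
  rw [rename_rename]
  have : (Equiv.swap i j : N → N) ∘ Equiv.swap i j = id := by
    funext x; simp
  rw [this, rename_id_apply]

theorem X_sub_X_dvd_sub_rename_swap [DecidableEq N] (i j : N) (f : MvPolynomial N K) :
    X i - X j ∣ f - rename (Equiv.swap i j) f := by
  induction f using MvPolynomial.induction_on with
  | C a => simp
  | add f g hf hg =>
    rw [map_add, add_sub_add_comm]; exact dvd_add hf hg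
  | mul_X f k hf =>
    have h : (X i - X j : MvPolynomial N K) ∣ X k - X (Equiv.swap i j k) := by
      rw [Equiv.swap_apply_def]
      split_ifs with h1 h2
      · rw [h1]
      · rw [h2]; exact dvd_sub_comm.1 dvd_rfl
      · simp
    have : f * X k - rename (Equiv.swap i j) (f * X k) =
        (f - rename (Equiv.swap i j) f) * X k +
          rename (Equiv.swap i j) f * (X k - X (Equiv.swap i j k)) := by
      rw [map_mul, rename_X]; ring
    rw [this]
    exact dvd_add (hf.mul_right _) (h.mul_left _)

/-- The form generates the kernel of the substitution of c⁻¹d X_v for X_u, an endomorphism of an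
integral domain. -/
theorem linear_prime {u v : N} (huv : u ≠ v) {c : K} (d : K) (hc : c ≠ 0) :
    Prime (C c * X u - C d * X v : MvPolynomial N K) := by
  classical
  set L : MvPolynomial N K := C c * X u - C d * X v with hL
  let φ : MvPolynomial N K →ₐ[K] MvPolynomial N K :=
    aeval (fun k => if k = u then C (c⁻¹ * d) * X v else X k)
  have hφL : φ L = 0 := by
    simp only [φ, hL, map_sub, map_mul, aeval_X, if_true, if_neg huv.symm, ← algebraMap_eq,
      AlgHom.commutes]
    have hcc : algebraMap K (MvPolynomial N K) c * algebraMap K _ c⁻¹ = 1 := by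
      rw [← map_mul, mul_inv_cancel₀ hc, map_one]
    linear_combination (algebraMap K (MvPolynomial N K) d * X v) * hcc
  have hdvd : ∀ f, L ∣ f - φ f := by
    intro f
    induction f using MvPolynomial.induction_on with
    | C a => simp [φ]
    | add f g hf hg => rw [map_add, add_sub_add_comm]; exact dvd_add hf hg
    | mul_X f k hf =>
      have h : L ∣ X k - φ (X k) := by
        simp only [φ, aeval_X]
        split_ifs with h1
        · refine ⟨C c⁻¹, ?_⟩
          rw [hL, h1]
          have : (C c * C c⁻¹ : MvPolynomial N K) = 1 := by
            rw [← map_mul, mul_inv_cancel₀ hc, map_one]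
          rw [map_mul]
          linear_combination (-(X u : MvPolynomial N K)) * this
        · simp
      have : f * X k - φ (f * X k) = (f - φ f) * X k + φ f * (X k - φ (X k)) := by
        rw [map_mul]; ring
      rw [this]
      exact dvd_add (hf.mul_right _) (h.mul_left _)
  have hiff : ∀ f, L ∣ f ↔ φ f = 0 := by
    intro f
    constructor
    · rintro ⟨g, rfl⟩; rw [map_mul, hφL, zero_mul]
    · intro h; have := hdvd f; rwa [h, sub_zero] at this
  refine ⟨linear_ne_zero huv hc, fun hu => ?_, fun f g h => ?_⟩
  · have := hu.map φ
    rw [hφL] at this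
    exact not_isUnit_zero this
  · rw [hiff, map_mul, mul_eq_zero] at h
    rwa [hiff, hiff]

theorem not_linear_dvd_linear {u v w w' : N} (huv : u ≠ v) (hwu : w ≠ u) (hwv : w ≠ v)
    (hw : w ≠ w') (c d : K) {c' : K} (d' : K) (hc' : c' ≠ 0) :
    ¬ (C c * X u - C d * X v : MvPolynomial N K) ∣ C c' * X w - C d' * X w' := by
  classical
  rintro ⟨g, hg⟩
  -- The point X_u = d, X_v = c is a zero of the divisor, while X_w = t remains free.
  have h : ∀ t : K, c' * t - d' * (if w' = u then d else if w' = v then c else 0) = 0 := by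
    intro t
    have := congrArg (eval (fun k => if k = w then t else if k = u then d else if k = v then c
      else 0)) hg
    simp only [map_mul, map_sub, eval_C, eval_X, if_true, if_neg hwu.symm, if_neg hwv.symm,
      if_neg huv.symm, if_neg hw.symm] at this
    rw [this]; ring
  have h0 := h 0
  have h1 := h 1
  apply hc'
  linear_combination h1 - h0

theorem not_linear_dvd_linear' {u v w w' : N} (huv : u ≠ v) (hwu : w ≠ u) (hwv : w ≠ v)
    (hw : w ≠ w') (c d : K) {c' : K} (d' : K) (hc' : c' ≠ 0) :
    ¬ (C c * X u - C d * X v : MvPolynomial N K) ∣ C d' * X w' - C c' * X w := by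
  rw [← dvd_neg, neg_sub]
  exact not_linear_dvd_linear huv hwu hwv hw c d d' hc'

/-- Linear forms in two pairs of variables with different supports do not divide each other. -/
theorem not_linear_dvd_of_support {u v i j : N} (huv : u ≠ v) (hij : i ≠ j)
    (h1 : ¬ (u = i ∧ v = j)) (h2 : ¬ (u = j ∧ v = i)) (c d : K) {c' d' : K} (hc' : c' ≠ 0)
    (hd' : d' ≠ 0) :
    ¬ (C c * X u - C d * X v : MvPolynomial N K) ∣ C c' * X i - C d' * X j := by
  by_cases h : i = u ∨ i = v
  · refine not_linear_dvd_linear' huv ?_ ?_ hij.symm c d c' hd'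
    · rintro rfl
      rcases h with h | rfl
      · exact hij h
      · exact h2 ⟨rfl, rfl⟩
    · rintro rfl
      rcases h with rfl | h
      · exact h1 ⟨rfl, rfl⟩
      · exact hij h
  · push Not at h
    exact not_linear_dvd_linear huv h.1 h.2 hij c d d' hc'

end LinearForms

/-! ### The operators on polynomials. -/

section BasisPolynomials

variable {m : ℕ} [NeZero m] {K : Type*} [Field K] {p q : K}

theorem z_fin (p q : K) (i : Fin (2 * m)) : z m p q i = X i := by
  unfold z
  rw [Nat.div_eq_of_lt i.isLt, pow_zero, C_1, one_mul]
  congr 1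
  ext
  exact Nat.mod_eq_of_lt i.isLt

theorem z_add (p q : K) (i c : ℕ) :
    z m p q (i + 2 * m * c) = C (((aParam p q)⁻¹ ^ 2) ^ c) * z m p q i := by
  have hm := Nat.pos_of_ne_zero (NeZero.ne m)
  have h1 : Fin.ofNat (2 * m) (i + 2 * m * c) = Fin.ofNat (2 * m) i := by
    ext; exact Nat.add_mul_mod_self_left _ _ _
  unfold z
  rw [h1, Nat.add_mul_div_left _ _ (by omega), pow_add, map_mul]
  ring

theorem b_fin (p q : K) (i j : Fin (2 * m)) : b m p q i j = C q * X i - C q⁻¹ * X j := by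
  unfold b; rw [z_fin, z_fin]

theorem b_add (p q : K) (i j c : ℕ) :
    b m p q (i + 2 * m * c) (j + 2 * m * c) = C (((aParam p q)⁻¹ ^ 2) ^ c) * b m p q i j := by
  unfold b; rw [z_add, z_add]; ring

theorem aParam_inv_ne_zero (hp : p ≠ 0) (hq : q ≠ 0) : (aParam p q)⁻¹ ^ 2 ≠ 0 := by
  unfold aParam; positivity

/-! ### The operators -/

theorem TBar.heckeOp_eq {F : Type*} [Field F] [Algebra (MvPolynomial (Fin (2 * m)) K) F]
    [IsFractionRing (MvPolynomial (Fin (2 * m)) K) F] (hp : p ≠ 0) (hq : q ≠ 0)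
    {i j : Fin (2 * m)} (hij : i ≠ j) {f g : MvPolynomial (Fin (2 * m)) K}
    (h : TBar p q i j f g) :
    heckeOp F p q i j (algebraMap _ F f) = algebraMap _ F g := by
  obtain ⟨φ, rfl, h⟩ := h
  rw [b_fin] at h ⊢
  have h' := congrArg (algebraMap _ F) h
  simp only [map_mul, map_sub, map_add] at h' ⊢
  have hX : ∀ k, algebraMap _ F (X k : MvPolynomial (Fin (2 * m)) K) = ratX _ K F k := fun _ => rfl
  have hC : ∀ c, algebraMap _ F (C c : MvPolynomial (Fin (2 * m)) K) = ratC _ K F c := fun _ => rfl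
  rw [← permAct_algebraMap] at h'
  simp only [hX, hC, ratC_inv] at h' ⊢
  rw [heckeOp_apply hp hq hij, heckeOpFun, heckeFun_mul (ratLinear_ne_zero hij.symm hq)]
  · have hx : ratX _ K F i - ratX _ K F j ≠ 0 := sub_ne_zero.2 (ratX_injective.ne hij)
    unfold demazureLusztig
    rw [← mul_right_inj' hx]
    field_simp at h' ⊢
    linear_combination -h'
  · simp only [map_sub, map_mul, map_inv₀, permAct_ratC, permAct_ratX, Equiv.swap_apply_left,
      Equiv.swap_apply_right]
    ring

theorem TBarInv.heckeOp_eq {F : Type*} [Field F] [Algebra (MvPolynomial (Fin (2 * m)) K) F]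
    [IsFractionRing (MvPolynomial (Fin (2 * m)) K) F] (hp : p ≠ 0) (hq : q ≠ 0)
    {i j : Fin (2 * m)} (hij : i ≠ j) {f g : MvPolynomial (Fin (2 * m)) K}
    (h : TBarInv p q i j f g) :
    (heckeOp F p q i j)⁻¹ (algebraMap _ F f) = algebraMap _ F g := by
  rw [← TBar.heckeOp_eq (F := F) hp hq hij h]
  exact Equiv.symm_apply_apply _ _

theorem TBar.unique (hp : p ≠ 0) (hq : q ≠ 0) {i j : Fin (2 * m)} (hij : i ≠ j)
    {f g g' : MvPolynomial (Fin (2 * m)) K} (h : TBar p q i j f g) (h' : TBar p q i j f g') :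
    g = g' := by
  refine IsFractionRing.injective _ (FractionRing (MvPolynomial (Fin (2 * m)) K)) ?_
  rw [← h.heckeOp_eq hp hq hij, ← h'.heckeOp_eq hp hq hij]

theorem TBarInv.unique (hp : p ≠ 0) (hq : q ≠ 0) {i j : Fin (2 * m)} (hij : i ≠ j)
    {f g g' : MvPolynomial (Fin (2 * m)) K} (h : TBarInv p q i j f g)
    (h' : TBarInv p q i j f g') : g = g' := by
  refine IsFractionRing.injective _ (FractionRing (MvPolynomial (Fin (2 * m)) K)) ?_
  rw [← TBarInv.heckeOp_eq hp hq hij h, ← TBarInv.heckeOp_eq hp hq hij h']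

/-- With f = bφ, the difference φ − sφ is (X_i − X_j)d, and `d` is symmetric because both other
terms are antisymmetric. The inverse is again T − (p − p⁻¹), and both results are multiples of b. -/
theorem exists_tBar_tBarInv (hp : p ≠ 0) {i j : Fin (2 * m)} (hij : i ≠ j)
    {f : MvPolynomial (Fin (2 * m)) K} (h : b m p q i j ∣ f) :
    ∃ g, TBar p q i j f g ∧ TBarInv p q i j f (g - C (p - p⁻¹) * f) := by
  obtain ⟨φ, rfl⟩ := h
  obtain ⟨d, hd⟩ := X_sub_X_dvd_sub_rename_swap i j φ
  have hx : (X i - X j : MvPolynomial (Fin (2 * m)) K) ≠ 0 :=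
    sub_ne_zero.2 (X_injective.ne hij)
  have hsd : rename (Equiv.swap i j) d = d := by
    have := congrArg (rename (Equiv.swap i j)) hd
    simp only [map_sub, map_mul, rename_X, Equiv.swap_apply_left, Equiv.swap_apply_right,
      rename_swap_rename_swap] at this
    rw [← mul_right_inj' hx]
    linear_combination hd + this
  have hpp : (C p * C p⁻¹ : MvPolynomial (Fin (2 * m)) K) = 1 := by
    rw [← map_mul, mul_inv_cancel₀ hp, map_one]
  refine ⟨b m p q i j * ((C p * X i - C p⁻¹ * X j) * d) - C p⁻¹ * (b m p q i j * φ),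
    ⟨φ, rfl, ?_⟩, ⟨(C p * X i - C p⁻¹ * X j) * d - C p * φ, ?_, ?_⟩⟩
  · linear_combination (-(b m p q i j * (C p * X i - C p⁻¹ * X j))) * hd
  · rw [map_sub]; ring
  · simp only [map_sub, map_mul, rename_X, rename_C, Equiv.swap_apply_left,
      Equiv.swap_apply_right, hsd]
    linear_combination (b m p q i j * (C p * X i - C p⁻¹ * X j) * C p) * hd -
      (X i - X j) * b m p q i j * φ * hpp

/-- By primality the form divides φ, and its swapped version does too, so the form also divides sφ.
It is coprime to X_i − X_j, which can therefore be cancelled. -/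
theorem TBar.linear_dvd {i j : Fin (2 * m)} (hq : q ≠ 0) (hij : i ≠ j)
    {f g : MvPolynomial (Fin (2 * m)) K}
    (h : TBar p q i j f g) {u v : Fin (2 * m)} (huv : u ≠ v) (h1 : ¬ (u = i ∧ v = j))
    (h2 : ¬ (u = j ∧ v = i)) {c d : K} (hc : c ≠ 0) (hf : C c * X u - C d * X v ∣ f)
    (hf' : C c * X (Equiv.swap i j u) - C d * X (Equiv.swap i j v) ∣ f) :
    C c * X u - C d * X v ∣ g := by
  obtain ⟨φ, rfl, h⟩ := h
  have hL := linear_prime (K := K) huv d hc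
  have huv' : Equiv.swap i j u ≠ Equiv.swap i j v := (Equiv.injective _).ne huv
  have h1' : ¬ (Equiv.swap i j u = i ∧ Equiv.swap i j v = j) := by
    rw [Equiv.swap_apply_eq_iff, Equiv.swap_apply_eq_iff, Equiv.swap_apply_left,
      Equiv.swap_apply_right]; exact h2
  have h2' : ¬ (Equiv.swap i j u = j ∧ Equiv.swap i j v = i) := by
    rw [Equiv.swap_apply_eq_iff, Equiv.swap_apply_eq_iff, Equiv.swap_apply_left,
      Equiv.swap_apply_right]; exact h1
  have hb := b_fin (m := m) p q i j
  have hφ : C c * X u - C d * X v ∣ φ := by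
    refine (hL.dvd_or_dvd hf).resolve_left ?_
    rw [hb]; exact not_linear_dvd_of_support huv hij h1 h2 c d hq (inv_ne_zero hq)
  have hφ' : C c * X u - C d * X v ∣ rename (Equiv.swap i j) φ := by
    have := ((linear_prime (K := K) huv' d hc).dvd_or_dvd hf').resolve_left (by
      rw [hb]; exact not_linear_dvd_of_support huv' hij h1' h2' c d hq (inv_ne_zero hq))
    have := map_dvd (rename (Equiv.swap i j)) this
    simpa using this
  have h3 : C c * X u - C d * X v ∣ (X i - X j) * (g + C p⁻¹ * (b m p q i j * φ)) := by
    rw [h]; exact ((hφ.sub hφ').mul_left _).mul_left _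
  have h4 := (hL.dvd_or_dvd h3).resolve_left (by
    have := not_linear_dvd_of_support (K := K) huv hij h1 h2 c d one_ne_zero one_ne_zero
    simpa using this)
  have h5 : C c * X u - C d * X v ∣ C p⁻¹ * (b m p q i j * φ) := (hφ.mul_left _).mul_left _
  exact (dvd_add_left h5).1 h4

end BasisPolynomials

/-! ### Matched pairs as arcs containing no strand. -/

section Matched

variable {m : ℕ}

/-- The point `x` is one of the cyclically consecutive points `l, …, k`, where `l < 2 * m`. -/
def InArc (m l k x : ℕ) : Prop := (l ≤ x ∧ x ≤ k) ∨ x + 2 * m ≤ k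

/-- No strand of `π` connects two of the points `l, …, k`. -/
def Tangle.FreeArc (π : Tangle m) (l k : ℕ) : Prop :=
  l < k ∧ k < l + 2 * m ∧ ∀ x, InArc m l k x.val → ¬ InArc m l k (π.partner x).val

theorem ofNat_val_of_lt [NeZero m] {a : ℕ} (h : a < 2 * m) : (Fin.ofNat (2 * m) a).val = a :=
  Nat.mod_eq_of_lt h

theorem ofNat_fin [NeZero m] (x : Fin (2 * m)) : Fin.ofNat (2 * m) x.val = x := by
  ext; exact ofNat_val_of_lt x.isLt

theorem ofNat_fin_add [NeZero m] (x : Fin (2 * m)) : Fin.ofNat (2 * m) (x.val + 2 * m) = x := by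
  ext
  show (x.val + 2 * m) % (2 * m) = x.val
  rw [Nat.add_mod_right, Nat.mod_eq_of_lt x.isLt]

theorem Tangle.matched_iff_freeArc [NeZero m] (π : Tangle m) {l k : ℕ} (hl : l < 2 * m) :
    π.Matched l k ↔ π.FreeArc l k := by
  constructor
  · rintro ⟨h1, h2⟩
    have key : ∀ x : Fin (2 * m), InArc m l k x.val → ∃ a, l ≤ a ∧ a ≤ k ∧
        Fin.ofNat (2 * m) a = x := by
      rintro x (h | h)
      · exact ⟨x, h.1, h.2, ofNat_fin x⟩
      · exact ⟨x + 2 * m, by omega, h, ofNat_fin_add x⟩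
    have h3 : ∀ x, InArc m l k x.val → ¬ InArc m l k (π.partner x).val := by
      intro x hx hy
      obtain ⟨a, a1, a2, a3⟩ := key _ hx
      obtain ⟨c, c1, c2, c3⟩ := key _ hy
      exact h2 a c a1 a2 c1 c2 (by rw [a3, c3])
    refine ⟨h1, ?_, h3⟩
    by_contra hk
    refine h3 ⟨l, hl⟩ (Or.inl ⟨le_rfl, h1.le⟩) ?_
    have := (π.partner ⟨l, hl⟩).isLt
    unfold InArc
    omega
  · rintro ⟨h1, h2, h3⟩
    refine ⟨h1, fun a c ha1 ha2 hc1 hc2 h => ?_⟩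
    have key : ∀ a, l ≤ a → a ≤ k → InArc m l k (Fin.ofNat (2 * m) a).val := by
      intro a h4 h5
      rcases lt_or_ge a (2 * m) with h6 | h6
      · rw [ofNat_val_of_lt h6]; exact Or.inl ⟨h4, h5⟩
      · have : (Fin.ofNat (2 * m) a).val = a - 2 * m := by
          show a % (2 * m) = _
          rw [Nat.mod_eq_sub_mod h6, Nat.mod_eq_of_lt (by omega)]
        rw [this]; right; omega
    exact h3 _ (key a ha1 ha2) (h ▸ key c hc1 hc2)

/-- Arithmetic core of `Tangle.freeArc_of_exchange`: `A` and `B` are the partners of i and i + 1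
before the exchange, `u'` and `v'` the swapped ends, and e = 2m when the arc passes the last point.
-/
theorem arc_exchange_aux {m i A B u v u' v' e : ℕ} (he : e = 0 ∨ e = 2 * m)
    (f1 : u < v + e) (f2 : v + e < u + 2 * m) (hu : u < 2 * m) (hv : v < 2 * m)
    (hi : i + 1 < 2 * m) (hA : A < 2 * m) (hB : B < 2 * m)
    (h1 : ¬(u = i ∧ v = i + 1)) (h2 : ¬(u = i + 1 ∧ v = i))
    (hAi : A ≠ i) (hAj : A ≠ i + 1) (hBi : B ≠ i) (hBj : B ≠ i + 1)
    (hcr : (B < i ∧ i + 1 < A) ∨ (i + 1 < A ∧ A < B) ∨ (A < B ∧ B < i))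
    (fi : InArc m u (v + e) i → ¬ InArc m u (v + e) B)
    (fj : InArc m u (v + e) (i + 1) → ¬ InArc m u (v + e) A)
    (hsu : (u = i ∧ u' = i + 1) ∨ (u = i + 1 ∧ u' = i) ∨ (u ≠ i ∧ u ≠ i + 1 ∧ u' = u))
    (hsv : (v = i ∧ v' = i + 1) ∨ (v = i + 1 ∧ v' = i) ∨ (v ≠ i ∧ v ≠ i + 1 ∧ v' = v)) :
    (InArc m u (v + e) i → ¬ InArc m u (v + e) A) ∧
    (InArc m u (v + e) (i + 1) → ¬ InArc m u (v + e) B) ∧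
    (u' < v' + e) ∧ (v' + e < u' + 2 * m) ∧
    (∀ y, y < 2 * m → y ≠ i → y ≠ i + 1 → InArc m u' (v' + e) y → InArc m u (v + e) y) ∧
    (InArc m u' (v' + e) i → ¬ InArc m u' (v' + e) A) ∧
    (InArc m u' (v' + e) (i + 1) → ¬ InArc m u' (v' + e) B) := by
  unfold InArc at *
  rcases hsu with ⟨rfl, rfl⟩ | ⟨rfl, rfl⟩ | ⟨u1, u2, rfl⟩ <;>
    rcases hsv with ⟨h3, rfl⟩ | ⟨h3, rfl⟩ | ⟨v1, v2, rfl⟩ <;>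
    first | (subst h3) | skip
  all_goals rcases he with rfl | rfl
  all_goals try (exfalso; omega)
  all_goals refine ⟨?_, ?_, ?_, ?_, fun y y0 y1 y2 => ?_, ?_, ?_⟩
  all_goals omega

/-- After the exchange the chords i–B and j–A do not cross, so the cyclic order is j, A, B, i. A
free arc starting at j stops before A, hence before B, and may be extended to i; an arc ending at i
is symmetric. If both points lie in the arc, `A` and `B` are outside. -/
theorem Tangle.freeArc_of_exchange {π : Tangle m} {i j : Fin (2 * m)}
    (h : π.UntwistPos i j ∨ π.UntwistInv i j) {u v : Fin (2 * m)} {e : ℕ}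
    (he : e = 0 ∨ e = 2 * m) (h1 : ¬ (u = i ∧ v = j)) (h2 : ¬ (u = j ∧ v = i))
    (hf : (π.exchange i j).FreeArc u.val (v.val + e)) :
    π.FreeArc u.val (v.val + e) ∧
      π.FreeArc (Equiv.swap i j u).val ((Equiv.swap i j v).val + e) := by
  have hne : π.partner i ≠ j :=
    h.elim Tangle.partner_ne_of_untwistPos Tangle.partner_ne_of_untwistInv
  have hne' : π.partner j ≠ i := fun e => hne (by rw [← e, π.partner_partner])
  have hij : i.val + 1 = j.val := h.elim (fun h => h.1) (fun h => h.1)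
  have hij' : i ≠ j := by simp only [ne_eq, Fin.ext_iff]; omega
  have hi := π.partner_ne i
  have hj := π.partner_ne j
  obtain ⟨f1, f2, f3⟩ := hf
  have fi := f3 i
  have fj := f3 j
  rw [π.exchange_left hne] at fi
  rw [π.exchange_right hne] at fj
  have fx : ∀ x, x ≠ i → x ≠ j → x ≠ π.partner i → x ≠ π.partner j →
      InArc m u.val (v.val + e) x.val → ¬ InArc m u.val (v.val + e) (π.partner x).val := by
    intro x x1 x2 x3 x4
    have := f3 x
    rwa [π.exchange_of_ne x1 x2, Equiv.swap_apply_of_ne_of_ne] at this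
    · exact fun h => x3 (by rw [← h, π.partner_partner])
    · exact fun h => x4 (by rw [← h, π.partner_partner])
  have hcr : ((π.partner j).val < i.val ∧ j.val < (π.partner i).val) ∨
      (j.val < (π.partner i).val ∧ (π.partner i).val < (π.partner j).val) ∨
      ((π.partner i).val < (π.partner j).val ∧ (π.partner j).val < i.val) := by
    rcases h with ⟨-, h⟩ | ⟨-, h⟩
    · exact Or.inl h
    · exact Or.inr h
  have key : ∀ l k : ℕ, (∀ y : Fin (2 * m), y ≠ i → y ≠ j → InArc m l k y.val →
      InArc m u.val (v.val + e) y.val) →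
      (InArc m l k i.val → ¬ InArc m l k (π.partner i).val) →
      (InArc m l k j.val → ¬ InArc m l k (π.partner j).val) →
      ∀ x, InArc m l k x.val → ¬ InArc m l k (π.partner x).val := by
    intro l k hy k1 k2 x
    by_cases x1 : x = i
    · rw [x1]; exact k1
    by_cases x2 : x = j
    · rw [x2]; exact k2
    by_cases x3 : x = π.partner i
    · rw [x3, π.partner_partner]; exact fun a b => k1 b a
    by_cases x4 : x = π.partner j
    · rw [x4, π.partner_partner]; exact fun a b => k2 b a
    exact fun a b => fx x x1 x2 x3 x4 (hy _ x1 x2 a)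
      (hy _ (fun h => x3 (by rw [← h, π.partner_partner]))
        (fun h => x4 (by rw [← h, π.partner_partner])) b)
  have hpij : π.partner i ≠ π.partner j := fun h => hij' (π.partner_inj.1 h)
  have hu := u.isLt
  have hv := v.isLt
  have hA := (π.partner i).isLt
  have hB := (π.partner j).isLt
  have hns : ∀ w : Fin (2 * m), (w.val = i.val ∧ (Equiv.swap i j w).val = i.val + 1) ∨
      (w.val = i.val + 1 ∧ (Equiv.swap i j w).val = i.val) ∨
      (w.val ≠ i.val ∧ w.val ≠ i.val + 1 ∧ (Equiv.swap i j w).val = w.val) := by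
    intro w
    rw [Equiv.swap_apply_def]
    simp only [ne_eq, Fin.ext_iff]
    split_ifs <;> omega
  have hj' := j.isLt
  simp only [ne_eq, Fin.ext_iff, ← hij] at h1 h2 hi hj hne hne' fj hcr hj'
  obtain ⟨g1, g2, g3, g4, g5, g6, g7⟩ := arc_exchange_aux he f1 f2 hu hv hj' hA hB h1 h2 hi hne
    hne' hj hcr fi fj (hns u) (hns v)
  rw [hij] at g2 g7
  refine ⟨⟨f1, f2, key _ _ (fun _ _ _ h => h) g1 g2⟩, ⟨g3, g4, key _ _ (fun y y1 y2 => ?_) g6 g7⟩⟩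
  rw [ne_eq, Fin.ext_iff] at y1 y2
  exact g5 y y.isLt y1 (by rw [hij]; exact y2)

/-- A matched pair is a translate of the ends of a free arc. -/
theorem Tangle.Matched.exists_freeArc [NeZero m] {π : Tangle m} {l k : ℕ} (h : π.Matched l k) :
    ∃ (u v : Fin (2 * m)) (e c : ℕ), (e = 0 ∨ e = 2 * m) ∧ u ≠ v ∧ π.FreeArc u (v + e) ∧
      l = u + 2 * m * c ∧ k = v + e + 2 * m * c := by
  have hm := Nat.pos_of_ne_zero (NeZero.ne m)
  have hl : l % (2 * m) < 2 * m := Nat.mod_lt _ (by omega)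
  have hdm := Nat.mod_add_div l (2 * m)
  set u := l % (2 * m)
  set c := l / (2 * m)
  obtain ⟨k', rfl⟩ : ∃ k', k = k' + 2 * m * c := ⟨k - 2 * m * c, by have := h.1; omega⟩
  have hmat : π.Matched u k' := by
    have hof : ∀ a, Fin.ofNat (2 * m) (a + 2 * m * c) = Fin.ofNat (2 * m) a := by
      intro a; ext; exact Nat.add_mul_mod_self_left _ _ _
    refine ⟨by have := h.1; omega, fun a a' h1 h2 h3 h4 => ?_⟩
    have := h.2 (a + 2 * m * c) (a' + 2 * m * c) (by omega) (by omega) (by omega) (by omega)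
    rwa [hof, hof] at this
  rw [Tangle.matched_iff_freeArc π hl] at hmat
  have h1 := hmat.1
  have h2 := hmat.2.1
  rcases lt_or_ge k' (2 * m) with hk | hk
  · exact ⟨⟨u, hl⟩, ⟨k', hk⟩, 0, c, .inl rfl, by simp only [ne_eq, Fin.ext_iff]; omega, hmat,
      hdm.symm, rfl⟩
  · refine ⟨⟨u, hl⟩, ⟨k' - 2 * m, by omega⟩, 2 * m, c, .inr rfl,
      by simp only [ne_eq, Fin.ext_iff]; omega, ?_, hdm.symm, ?_⟩
    · have : k' - 2 * m + 2 * m = k' := by omega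
      simpa only [this] using hmat
    · simp only; omega

end Matched

/-! ### Divisibility along the moves, and existence. -/

section Divisibility

variable {m : ℕ} [NeZero m] {K : Type*} [Field K] {p q : K}

/-- `f` is divisible by `b_{lk}` for all pairs `l, k` that are matched in `π`. -/
def DvdMatched (p q : K) (π : Tangle m) (f : MvPolynomial (Fin (2 * m)) K) : Prop :=
  ∀ l k, π.Matched l k → b m p q l k ∣ f

theorem exists_b_eq_linear (hp : p ≠ 0) (hq : q ≠ 0) {e : ℕ} (he : e = 0 ∨ e = 2 * m) :
    ∃ d : K, d ≠ 0 ∧ ∀ u v : Fin (2 * m), b m p q u (v + e) = C q * X u - C d * X v := by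
  rcases he with rfl | rfl
  · exact ⟨q⁻¹, inv_ne_zero hq, fun u v => b_fin p q u v⟩
  · refine ⟨q⁻¹ * (aParam p q)⁻¹ ^ 2, mul_ne_zero (inv_ne_zero hq) (aParam_inv_ne_zero hp hq),
      fun u v => ?_⟩
    have := z_add (m := m) p q v.val 1
    rw [mul_one, pow_one] at this
    unfold b
    rw [this, z_fin, z_fin, map_mul]; ring

theorem dvdMatched_of_freeArc (hp : p ≠ 0) (hq : q ≠ 0) {π : Tangle m}
    {f : MvPolynomial (Fin (2 * m)) K}
    (h : ∀ (u v : Fin (2 * m)) (e : ℕ), (e = 0 ∨ e = 2 * m) → u ≠ v → π.FreeArc u (v + e) →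
      b m p q u (v + e) ∣ f) : DvdMatched p q π f := by
  intro l k hlk
  obtain ⟨u, v, e, c, he, huv, hf, rfl, rfl⟩ := hlk.exists_freeArc
  rw [b_add]
  have hu : IsUnit (C (((aParam p q)⁻¹ ^ 2) ^ c) : MvPolynomial (Fin (2 * m)) K) :=
    (IsUnit.mk0 _ (pow_ne_zero _ (aParam_inv_ne_zero hp hq))).map C
  exact (hu.mul_left_dvd).2 (h u v e he huv hf)

theorem dvdMatched_rho (hp : p ≠ 0) (hq : q ≠ 0) :
    DvdMatched p q (Tangle.rho m) (rhoBar m p q) := by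
  refine dvdMatched_of_freeArc hp hq (fun u v e he huv ⟨h1, h2, h3⟩ => ?_)
  have h4 := h3 u (Or.inl ⟨le_rfl, h1.le⟩)
  have h5 := Tangle.rho_val u
  have hu := u.isLt
  unfold InArc at h4
  obtain ⟨d, hd⟩ : ∃ d, v.val + e = u.val + d := ⟨v.val + e - u.val, by omega⟩
  rw [hd]
  -- A free arc cannot contain the antipode of its first point, so its length is less than m.
  have hmem : d ∈ Finset.Icc 1 (m - 1) := by rw [Finset.mem_Icc]; omega
  exact (Finset.dvd_prod_of_mem (fun k => b m p q u (u + k)) hmem).trans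
    (Finset.dvd_prod_of_mem (fun i => ∏ k ∈ Finset.Icc 1 (m - 1), b m p q i (i + k))
      (Finset.mem_range.2 u.isLt))

theorem Tangle.matched_of_partner_ne {π : Tangle m} {i j : Fin (2 * m)}
    (hij : i.val + 1 = j.val) (h : π.partner i ≠ j) : π.Matched i j := by
  refine ⟨by omega, fun a c h1 h2 h3 h4 => ?_⟩
  have h5 : π.partner j ≠ i := fun e => h (by rw [← e, π.partner_partner])
  have ha : a = i.val ∨ a = j.val := by omega
  have hc : c = i.val ∨ c = j.val := by omega
  rcases ha with rfl | rfl <;> rcases hc with rfl | rfl <;> simp only [ofNat_fin]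
  exacts [π.partner_ne _, h, h5, π.partner_ne _]

/-- The constant `c` covers both operators: 0 for t̄ and p − p⁻¹ for its inverse. The pair (i, j) is
handled by `hg`; an arc from j around to i contains every point and is never free. -/
theorem DvdMatched.of_tBar (hp : p ≠ 0) (hq : q ≠ 0) {π : Tangle m}
    {f g : MvPolynomial (Fin (2 * m)) K} (hf : DvdMatched p q π f) {i j : Fin (2 * m)}
    (hu : π.UntwistPos i j ∨ π.UntwistInv i j) (h : TBar p q i j f g)
    {g' : MvPolynomial (Fin (2 * m)) K} {c : K} (hg : b m p q i j ∣ g')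
    (hg' : g' = g - C c * f) :
    DvdMatched p q (π.exchange i j) g' := by
  have hij : i.val + 1 = j.val := hu.elim (fun h => h.1) (fun h => h.1)
  have hij' : i ≠ j := by simp only [ne_eq, Fin.ext_iff]; omega
  refine dvdMatched_of_freeArc hp hq (fun u v e he huv hfree => ?_)
  by_cases h1 : u = i ∧ v = j
  · obtain ⟨rfl, rfl⟩ := h1
    have : e = 0 := by have := hfree.2.1; omega
    subst this
    exact hg
  by_cases h2 : u = j ∧ v = i
  · obtain ⟨rfl, rfl⟩ := h2
    exfalso
    have hfi := hfree.2.2 u (Or.inl ⟨le_rfl, hfree.1.le⟩)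
    have := ((π.exchange v u).partner u).isLt
    have := (π.exchange v u).partner_ne u
    have := hfree.1
    unfold InArc at hfi
    simp only [ne_eq, Fin.ext_iff] at *
    omega
  obtain ⟨f1, f2⟩ := Tangle.freeArc_of_exchange hu he h1 h2 hfree
  have hm1 := hf _ _ ((Tangle.matched_iff_freeArc π u.isLt).2 f1)
  have hm2 := hf _ _ ((Tangle.matched_iff_freeArc π (Equiv.swap i j u).isLt).2 f2)
  obtain ⟨d, -, hd⟩ := exists_b_eq_linear (m := m) hp hq he
  rw [hd] at hm1 hm2 ⊢
  rw [hg']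
  exact (h.linear_dvd hq hij' huv h1 h2 hq hm1 hm2).sub (hm1.mul_left _)

theorem IsBasisPoly.dvdMatched (hp : p ≠ 0) (hq : q ≠ 0) {π : Tangle m}
    {f : MvPolynomial (Fin (2 * m)) K} (h : IsBasisPoly p q π f) : DvdMatched p q π f := by
  induction h with
  | rho => exact dvdMatched_rho hp hq
  | @pos π f g i j _ hu ht ih =>
    refine ih.of_tBar hp hq (.inl hu) ht (c := 0) ?_ (by simp)
    have hij : i ≠ j := by have := hu.1; simp only [ne_eq, Fin.ext_iff]; omega
    obtain ⟨g', h1, h2⟩ := exists_tBar_tBarInv hp hij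
      (ih i j (Tangle.matched_of_partner_ne hu.1 (Tangle.partner_ne_of_untwistPos hu)))
    rw [ht.unique hp hq hij h1]
    obtain ⟨φ, hφ, -⟩ := h2
    have h3 : b m p q i j ∣ C (p - p⁻¹) * f := (ih i j (Tangle.matched_of_partner_ne hu.1
      (Tangle.partner_ne_of_untwistPos hu))).mul_left _
    exact (dvd_sub_left h3).1 ⟨φ, hφ⟩
  | @inv π f g i j _ hu ht ih =>
    have hij : i ≠ j := by have := hu.1; simp only [ne_eq, Fin.ext_iff]; omega
    obtain ⟨g', h1, h2⟩ := exists_tBar_tBarInv hp hij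
      (ih i j (Tangle.matched_of_partner_ne hu.1 (Tangle.partner_ne_of_untwistInv hu)))
    obtain ⟨φ, hφ, -⟩ := id ht
    exact ih.of_tBar hp hq (.inr hu) h1 ⟨φ, hφ⟩ (TBarInv.unique hp hq hij ht h2)

theorem IsBasisPoly.exists (hp : p ≠ 0) (hq : q ≠ 0) (π : Tangle m) :
    ∃ f, IsBasisPoly p q π f := by
  induction π using Tangle.rankInduction with
  | h0 => exact ⟨_, .rho⟩
  | hs π i j hij ih =>
    obtain ⟨f, hf⟩ := ih
    have hm : (π.exchange i j).Matched i j := Tangle.matched_of_partner_ne hij.1 (by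
      rw [π.exchange_left hij.2.1]; exact π.partner_ne j)
    obtain ⟨g, h1, h2⟩ := exists_tBar_tBarInv hp hij.ne (hf.dvdMatched hp hq i j hm)
    rw [← π.exchange_exchange i j]
    by_cases hd : π.Diverge i j
    · exact ⟨_, hf.pos (hij.untwist.1 hd) h1⟩
    · exact ⟨_, hf.inv (hij.untwist.2 hd) h2⟩

end Divisibility

/-! ### The parallel relation for ρ̄, and uniqueness. -/

section RhoBar

variable {m : ℕ} [NeZero m] {K : Type*} [Field K] {p q : K}

/-- The factor of `ρ̄` belonging to an ordered pair of points. -/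
noncomputable def pairFactor (m : ℕ) [NeZero m] (p q : K) (u v : Fin (2 * m)) :
    MvPolynomial (Fin (2 * m)) K :=
  if u.val < v.val ∧ v.val < u.val + m then b m p q u v
  else if v.val + m < u.val then b m p q u (v.val + 2 * m) else 1

theorem rhoBar_eq_prod_pairFactor :
    rhoBar m p q = ∏ x : Fin (2 * m) × Fin (2 * m), pairFactor m p q x.1 x.2 := by
  have hm := Nat.pos_of_ne_zero (NeZero.ne m)
  rw [Fintype.prod_prod_type]
  unfold rhoBar
  rw [Finset.prod_range]
  refine Finset.prod_congr rfl (fun u _ => ?_)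
  have hu := u.isLt
  have h1 : ∀ v : Fin (2 * m), pairFactor m p q u v =
      if (u.val < v.val ∧ v.val < u.val + m) ∨ v.val + m < u.val then pairFactor m p q u v
      else 1 := by
    intro v
    split_ifs with h
    · rfl
    · push Not at h
      unfold pairFactor
      rw [if_neg (by omega), if_neg (by omega)]
  rw [Finset.prod_congr rfl (fun v _ => h1 v), ← Finset.prod_filter]
  refine Finset.prod_bij' (fun d _ => Fin.ofNat (2 * m) (u.val + d))
    (fun v _ => if u.val < v.val then v.val - u.val else v.val + 2 * m - u.val) ?_ ?_ ?_ ?_ ?_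
  all_goals simp only [Finset.mem_Icc, Finset.mem_filter, Finset.mem_univ, true_and]
  · intro d hd
    rcases lt_or_ge (u.val + d) (2 * m) with h | h
    · rw [ofNat_val_of_lt h]; omega
    · have : (Fin.ofNat (2 * m) (u.val + d)).val = u.val + d - 2 * m := by
        show (u.val + d) % (2 * m) = _
        rw [Nat.mod_eq_sub_mod h, Nat.mod_eq_of_lt (by omega)]
      rw [this]; omega
  · intro v hv
    split_ifs <;> omega
  · intro d hd
    rcases lt_or_ge (u.val + d) (2 * m) with h | h
    · rw [ofNat_val_of_lt h]; split_ifs <;> omega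
    · have : (Fin.ofNat (2 * m) (u.val + d)).val = u.val + d - 2 * m := by
        show (u.val + d) % (2 * m) = _
        rw [Nat.mod_eq_sub_mod h, Nat.mod_eq_of_lt (by omega)]
      rw [this]; split_ifs <;> omega
  · intro v hv
    split_ifs with h
    · rw [show u.val + (v.val - u.val) = v.val by omega, ofNat_fin]
    · rw [show u.val + (v.val + 2 * m - u.val) = v.val + 2 * m by omega, ofNat_fin_add]
  · intro d hd
    unfold pairFactor
    rcases lt_or_ge (u.val + d) (2 * m) with h | h
    · rw [ofNat_val_of_lt h, if_pos (by omega)]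
    · have : (Fin.ofNat (2 * m) (u.val + d)).val = u.val + d - 2 * m := by
        show (u.val + d) % (2 * m) = _
        rw [Nat.mod_eq_sub_mod h, Nat.mod_eq_of_lt (by omega)]
      rw [this, if_neg (by omega), if_pos (by omega)]
      congr 1; omega

theorem b_fin_add (p q : K) (u v : Fin (2 * m)) :
    b m p q u (v.val + 2 * m) = C q * X u - C (q⁻¹ * (aParam p q)⁻¹ ^ 2) * X v := by
  have := z_add (m := m) p q v.val 1
  rw [mul_one, pow_one] at this
  unfold b
  rw [this, z_fin, z_fin, map_mul]; ring

theorem rename_pairFactor (p q : K) {i i' u v u' v' : Fin (2 * m)}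
    (hu : Equiv.swap i i' u = u') (hv : Equiv.swap i i' v = v')
    (h1 : (u.val < v.val ∧ v.val < u.val + m) ↔ (u'.val < v'.val ∧ v'.val < u'.val + m))
    (h2 : v.val + m < u.val ↔ v'.val + m < u'.val) :
    rename (Equiv.swap i i') (pairFactor m p q u v) = pairFactor m p q u' v' := by
  unfold pairFactor
  simp only [← h1, ← h2]
  split_ifs
  · rw [b_fin, b_fin]; simp [hu, hv]
  · rw [b_fin_add, b_fin_add]; simp [hu, hv]
  · simp

/-- The product of the factors of `ρ̄` for the pairs which are not contained in `s`. -/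
noncomputable def coProd (m : ℕ) [NeZero m] (p q : K) (s : Finset (Fin (2 * m))) :
    MvPolynomial (Fin (2 * m)) K :=
  ∏ x ∈ (s ×ˢ s)ᶜ, pairFactor m p q x.1 x.2

/-- A point other than i, i' and their antipodes lies on the same side of i and of i', and likewise
of their antipodes. Thus the swap merely permutes the remaining factors. -/
theorem rename_coProd (p q : K) {i i' : Fin (2 * m)} (hi : i.val + 1 = i'.val)
    {s : Finset (Fin (2 * m))} (h1 : i ∈ s) (h2 : i' ∈ s)
    (h3 : ∀ x : Fin (2 * m), x.val = i.val + m ∨ x.val + m = i.val ∨ x.val = i'.val + m ∨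
      x.val + m = i'.val → x ∈ s) :
    rename (Equiv.swap i i') (coProd m p q s) = coProd m p q s := by
  have hs : ∀ x, Equiv.swap i i' x ∈ s ↔ x ∈ s := by
    intro x
    rw [Equiv.swap_apply_def]
    split_ifs with a b
    · rw [a]; simp [h1, h2]
    · rw [b]; simp [h1, h2]
    · rfl
  unfold coProd
  rw [map_prod]
  refine Finset.prod_equiv (Equiv.prodCongr (Equiv.swap i i') (Equiv.swap i i')) ?_ ?_
  · rintro ⟨u, v⟩
    simp [hs]
  · rintro ⟨u, v⟩ huv
    simp only [Finset.mem_compl, Finset.mem_product, not_and] at huv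
    refine rename_pairFactor p q rfl rfl ?_ ?_
    all_goals
      simp only [Equiv.prodCongr_apply, Prod.map]
      have hu := h3 u
      have hv := h3 v
      have hu1 : u = i → u ∈ s := fun h => h ▸ h1
      have hu2 : u = i' → u ∈ s := fun h => h ▸ h2
      have hv1 : v = i → v ∈ s := fun h => h ▸ h1
      have hv2 : v = i' → v ∈ s := fun h => h ▸ h2
      have := u.isLt
      have := v.isLt
      have := i'.isLt
      rw [Equiv.swap_apply_def, Equiv.swap_apply_def]
      clear h3 hs
      generalize (u ∈ s) = P at *
      generalize (v ∈ s) = Q at *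
      simp only [Fin.ext_iff] at *
      by_cases hP : P <;> by_cases hQ : Q <;>
      simp only [hP, hQ, not_true_eq_false, imp_false, imp_true_iff, not_false_eq_true] at * <;>
      split_ifs <;> omega

/-- Among the four points only neighbours and the two pairs at cyclic distance m − 1 contribute a
factor; antipodal pairs contribute none. -/
theorem rhoBar_eq_coProd_mul {i i' j j' : Fin (2 * m)} (hi : i.val + 1 = i'.val)
    (hj : j.val + 1 = j'.val) (hij : j.val = i.val + m) :
    rhoBar m p q = coProd m p q {i, i', j, j'} * (b m p q i i' * b m p q j j' *
      (b m p q i' j * b m p q j' (i.val + 2 * m))) := by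
  have hj' := j'.isLt
  have hone : ∀ u v : Fin (2 * m), ¬ (u.val < v.val ∧ v.val < u.val + m) →
      ¬ (v.val + m < u.val) → pairFactor m p q u v = 1 := by
    intro u v h1 h2
    unfold pairFactor
    rw [if_neg h1, if_neg h2]
  have hb : ∀ u v : Fin (2 * m), (u.val < v.val ∧ v.val < u.val + m) →
      pairFactor m p q u v = b m p q u v := by
    intro u v h1
    unfold pairFactor
    rw [if_pos h1]
  have e1 := hb i i' (by omega)
  have e2 := hb j j' (by omega)
  have e3 := hb i' j (by omega)
  have e4 : pairFactor m p q j' i = b m p q j' (i.val + 2 * m) := by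
    unfold pairFactor
    rw [if_neg (by omega), if_pos (by omega)]
  have n1 : i ≠ i' := by simp only [ne_eq, Fin.ext_iff]; omega
  have n2 : i ≠ j := by simp only [ne_eq, Fin.ext_iff]; omega
  have n3 : i ≠ j' := by simp only [ne_eq, Fin.ext_iff]; omega
  have n4 : i' ≠ j := by simp only [ne_eq, Fin.ext_iff]; omega
  have n5 : i' ≠ j' := by simp only [ne_eq, Fin.ext_iff]; omega
  have n6 : j ≠ j' := by simp only [ne_eq, Fin.ext_iff]; omega
  rw [rhoBar_eq_prod_pairFactor, ← Finset.prod_compl_mul_prod ({i, i', j, j'} ×ˢ {i, i', j, j'}),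
    coProd, Finset.prod_product]
  congr 1
  have hQ : ∀ f : Fin (2 * m) → MvPolynomial (Fin (2 * m)) K,
      ∏ x ∈ ({i, i', j, j'} : Finset (Fin (2 * m))), f x = f i * (f i' * (f j * f j')) := by
    intro f
    rw [Finset.prod_insert (by simp [n1, n2, n3]), Finset.prod_insert (by simp [n4, n5]),
      Finset.prod_insert (by simp [n6]), Finset.prod_singleton]
  simp only [hQ]
  rw [e1, e2, e3, e4, hone i i, hone i j, hone i j', hone i' i, hone i' i', hone i' j', hone j i,
    hone j i', hone j j, hone j' i', hone j' j, hone j' j']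
  · ring
  all_goals omega

/-- `S` and the two neighbour factors form a `D` valid in `heckeFun_mul` for both swaps. It remains
to compare two Demazure–Lusztig operators on the last two factors. The coefficient P²Q³ is q⁻¹a⁻²,
from the label that wraps around. -/
theorem heckeOp_rhoBar_aux {F : Type*} [Field F] {P Q x y u w : F} (hP : P ≠ 0) (hQ : Q ≠ 0)
    (hxy : x ≠ y) (huw : u ≠ w) {s t : F ≃+* F} (sP : s P = P) (tP : t P = P) (sQ : s Q = Q)
    (tQ : t Q = Q) (sx : s x = y) (sy : s y = x) (su : s u = u) (sw : s w = w) (tx : t x = x)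
    (ty : t y = y) (tu : t u = w) (tw : t w = u) {S : F} (sS : s S = S) (tS : t S = S)
    (g1 : Q * y - Q⁻¹ * x ≠ 0) (g2 : Q * w - Q⁻¹ * u ≠ 0) :
    heckeFun P Q x y s (S * ((Q * x - Q⁻¹ * y) * (Q * u - Q⁻¹ * w) *
      ((Q * y - Q⁻¹ * u) * (Q * w - (P ^ 2 * Q ^ 3) * x)))) =
    heckeFun P Q u w t (S * ((Q * x - Q⁻¹ * y) * (Q * u - Q⁻¹ * w) *
      ((Q * y - Q⁻¹ * u) * (Q * w - (P ^ 2 * Q ^ 3) * x)))) := by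
  have h1 : x - y ≠ 0 := sub_ne_zero.2 hxy
  have h2 : u - w ≠ 0 := sub_ne_zero.2 huw
  rw [← mul_assoc S]
  rw [heckeFun_mul g1, heckeFun_mul g2]
  · congr 1
    unfold demazureLusztig
    simp only [map_sub, map_mul, map_pow, map_inv₀, sP, sQ, sx, sy, su, sw, tP, tQ, tx, ty, tu, tw]
    field_simp
    ring
  · simp only [map_sub, map_mul, map_inv₀, tQ, tx, ty, tu, tw, tS]
    ring
  · simp only [map_sub, map_mul, map_inv₀, sQ, sx, sy, su, sw, sS]
    ring

theorem heckeOp_rhoBar {F : Type*} [Field F] [Algebra (MvPolynomial (Fin (2 * m)) K) F]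
    [IsFractionRing (MvPolynomial (Fin (2 * m)) K) F] (hp : p ≠ 0) (hq : q ≠ 0)
    {i i' j j' : Fin (2 * m)} (hi : i.val + 1 = i'.val)
    (hj : j.val + 1 = j'.val) (hij : j.val = i.val + m) :
    heckeOp F p q i i' (algebraMap _ F (rhoBar m p q)) =
      heckeOp F p q j j' (algebraMap _ F (rhoBar m p q)) := by
  have hj' := j'.isLt
  have hm := Nat.pos_of_ne_zero (NeZero.ne m)
  have n1 : i ≠ i' := by simp only [ne_eq, Fin.ext_iff]; omega
  have n2 : i ≠ j := by simp only [ne_eq, Fin.ext_iff]; omega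
  have n3 : i ≠ j' := by simp only [ne_eq, Fin.ext_iff]; omega
  have n4 : i' ≠ j := by simp only [ne_eq, Fin.ext_iff]; omega
  have n5 : i' ≠ j' := by simp only [ne_eq, Fin.ext_iff]; omega
  have n6 : j ≠ j' := by simp only [ne_eq, Fin.ext_iff]; omega
  have hX : ∀ k, algebraMap _ F (X k : MvPolynomial (Fin (2 * m)) K) = ratX _ K F k := fun _ => rfl
  have hC : ∀ c, algebraMap _ F (C c : MvPolynomial (Fin (2 * m)) K) = ratC _ K F c := fun _ => rfl
  have ha : q⁻¹ * (aParam p q)⁻¹ ^ 2 = p ^ 2 * q ^ 3 := by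
    unfold aParam; field_simp
  rw [rhoBar_eq_coProd_mul hi hj hij, heckeOp_apply hp hq n1, heckeOp_apply hp hq n6,
    b_fin_add, b_fin, b_fin, b_fin, ha]
  simp only [map_mul, map_sub, map_pow, hX, hC, ratC_inv]
  unfold heckeOpFun
  have hsym : ∀ k k' : Fin (2 * m), k.val + 1 = k'.val → k ∈ ({i, i', j, j'} : Finset _) →
      k' ∈ ({i, i', j, j'} : Finset (Fin (2 * m))) → (k = i ∨ k = j) →
      permAct _ K F (Equiv.swap k k') (algebraMap _ F (coProd m p q {i, i', j, j'})) =
        algebraMap _ F (coProd m p q {i, i', j, j'}) := by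
    intro k k' hk h1 h2 h3
    rw [permAct_algebraMap, rename_coProd p q hk h1 h2]
    intro x hx
    have := x.isLt
    simp only [Finset.mem_insert, Finset.mem_singleton, Fin.ext_iff] at h3 ⊢
    omega
  exact heckeOp_rhoBar_aux (ratC_ne_zero hp) (ratC_ne_zero hq) (ratX_injective.ne n1)
    (ratX_injective.ne n6) (permAct_ratC _ _) (permAct_ratC _ _) (permAct_ratC _ _)
    (permAct_ratC _ _)
    (by rw [permAct_ratX, Equiv.swap_apply_left]) (by rw [permAct_ratX, Equiv.swap_apply_right])
    (by rw [permAct_ratX, Equiv.swap_apply_of_ne_of_ne n2.symm n4.symm])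
    (by rw [permAct_ratX, Equiv.swap_apply_of_ne_of_ne n3.symm n5.symm])
    (by rw [permAct_ratX, Equiv.swap_apply_of_ne_of_ne n2 n3])
    (by rw [permAct_ratX, Equiv.swap_apply_of_ne_of_ne n4 n5])
    (by rw [permAct_ratX, Equiv.swap_apply_left]) (by rw [permAct_ratX, Equiv.swap_apply_right])
    (hsym i i' hi (by simp) (by simp) (.inl rfl)) (hsym j j' hj (by simp) (by simp) (.inr rfl))
    (ratLinear_ne_zero n1.symm hq) (ratLinear_ne_zero n6.symm hq)

/-- The operators `t̄` on rational functions with the base vector `ρ̄`. -/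
noncomputable def heckeAction (m : ℕ) [NeZero m] (F : Type*) [Field F]
    [Algebra (MvPolynomial (Fin (2 * m)) K) F]
    [IsFractionRing (MvPolynomial (Fin (2 * m)) K) F] (hp : p ≠ 0) (hq : q ≠ 0) :
    BraidAction m F where
  op := heckeOp F p q
  base := algebraMap _ F (rhoBar m p q)
  braid _ _ _ h1 h2 h3 := heckeOp_braid hp hq h1 h2 h3
  comm _ _ _ _ h1 h2 h3 h4 h5 h6 := heckeOp_comm hp hq h1 h2 h3 h4 h5 h6
  inv_eq i j k l v hij hkl h := by
    rw [heckeOp_inv_apply hp hq hij, heckeOp_inv_apply hp hq hkl, h]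
  parallel i i' j j' hi hj h1 h2 := by
    have := Tangle.rho_val i
    rw [h1] at this
    rcases this with ⟨h, -⟩ | ⟨h, -⟩
    · exact heckeOp_rhoBar hp hq hi hj h
    · exact (heckeOp_rhoBar hp hq hj hi h.symm).symm

theorem IsBasisPoly.reach {F : Type*} [Field F] [Algebra (MvPolynomial (Fin (2 * m)) K) F]
    [IsFractionRing (MvPolynomial (Fin (2 * m)) K) F] (hp : p ≠ 0) (hq : q ≠ 0) {π : Tangle m}
    {f : MvPolynomial (Fin (2 * m)) K} (h : IsBasisPoly p q π f) :
    (heckeAction m F hp hq).Reach π (algebraMap _ F f) := by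
  induction h with
  | rho => exact .rho
  | @pos π f g i j _ hu ht ih =>
    have hij : i ≠ j := by have := hu.1; simp only [ne_eq, Fin.ext_iff]; omega
    rw [← ht.heckeOp_eq hp hq hij]
    exact BraidAction.Reach.pos _ ih hu
  | @inv π f g i j _ hu ht ih =>
    have hij : i ≠ j := by have := hu.1; simp only [ne_eq, Fin.ext_iff]; omega
    rw [← TBarInv.heckeOp_eq hp hq hij ht]
    exact BraidAction.Reach.inv _ ih hu

theorem IsBasisPoly.unique (hp : p ≠ 0) (hq : q ≠ 0) {π : Tangle m}
    {f g : MvPolynomial (Fin (2 * m)) K} (hf : IsBasisPoly p q π f) (hg : IsBasisPoly p q π g) :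
    f = g :=
  IsFractionRing.injective _ (FractionRing (MvPolynomial (Fin (2 * m)) K))
    ((BraidAction.coherent π).1 _ _ (hf.reach hp hq) (hg.reach hp hq))

end RhoBar

end BMW

theorem mainTheorem4 {K : Type*} [Field K] (m : ℕ) [NeZero m] (p q : K)
    (hp : p ≠ 0) (hq : q ≠ 0) :
    -- the construction of the basis polynomials from `ρ̄` is consistent: every tangle `π` is
    -- reached, and its polynomial `π̄` does not depend on the sequence of moves
    (∀ π : BMW.Tangle m, ∃! f : MvPolynomial (Fin (2 * m)) K, BMW.IsBasisPoly p q π f) ∧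
    -- if `j` and `k` are matched in `π`, then `b_{jk}` divides `π̄`
    (∀ (π : BMW.Tangle m) (f : MvPolynomial (Fin (2 * m)) K), BMW.IsBasisPoly p q π f →
      ∀ j k : ℕ, π.Matched j k → BMW.b m p q j k ∣ f) ∧
    -- each polynomial on which `t̄_i` or its inverse acts in the construction is divisible by
    -- `b_{i,i+1}`, and the action on it is defined
    (∀ (π : BMW.Tangle m) (f : MvPolynomial (Fin (2 * m)) K), BMW.IsBasisPoly p q π f →
      ∀ i j : Fin (2 * m),
        (π.UntwistPos i j →
          BMW.b m p q i j ∣ f ∧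
            ∃! g : MvPolynomial (Fin (2 * m)) K, BMW.TBar p q i j f g) ∧
        (π.UntwistInv i j →
          BMW.b m p q i j ∣ f ∧
            ∃! g : MvPolynomial (Fin (2 * m)) K, BMW.TBarInv p q i j f g)) := by
  refine ⟨fun π => ?_, fun π f hf => hf.dvdMatched hp hq, fun π f hf i j => ⟨fun hu => ?_,
    fun hu => ?_⟩⟩
  · obtain ⟨f, hf⟩ := BMW.IsBasisPoly.exists hp hq π
    exact ⟨f, hf, fun g hg => hg.unique hp hq hf⟩
  · have hij : i ≠ j := by have := hu.1; simp only [ne_eq, Fin.ext_iff]; omega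
    have hb := hf.dvdMatched hp hq i j
      (BMW.Tangle.matched_of_partner_ne hu.1 (BMW.Tangle.partner_ne_of_untwistPos hu))
    obtain ⟨g, hg, -⟩ := BMW.exists_tBar_tBarInv hp hij hb
    exact ⟨hb, g, hg, fun g' hg' => hg'.unique hp hq hij hg⟩
  · have hij : i ≠ j := by have := hu.1; simp only [ne_eq, Fin.ext_iff]; omega
    have hb := hf.dvdMatched hp hq i j
      (BMW.Tangle.matched_of_partner_ne hu.1 (BMW.Tangle.partner_ne_of_untwistInv hu))
    obtain ⟨g, -, hg⟩ := BMW.exists_tBar_tBarInv hp hij hb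
    exact ⟨hb, _, hg, fun g' hg' => BMW.TBarInv.unique hp hq hij hg' hg⟩
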